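/- For $s\in\mathbb R$ and $1\le p\le\infty$ let $\|u\|_{W^{s,p}}=\|(1-\Delta)^{s/2}u\|_{L^p(\mathbb R^d)}$ be the inhomogeneous Sobolev (Bessel potential) norm, where $(1-\Delta)^{s/2}$ acts on tempered distributions as a Fourier multiplier, and let $H^s=W^{s,2}$. Put $s_c=\frac d2-1$, $s_\epsilon=s_c+\epsilon$ and $r_\epsilon=\frac{2d}{d+2(1-\epsilon)}$. (i) Let $d\ge 3$ and $0<\epsilon<\frac{d+2}{2}$ (the range of $\epsilon>0$ for which $r_\epsilon$ is a finite positive exponent). There is a constant $C=C(d,\epsilon)$ such that for every $\phi\in H^{s_\epsilon}(\mathbb R^d)$ the function $|\phi|^2\phi$ belongs to $W^{-(s_c+\frac\epsilon2),r_\epsilon}(\mathbb R^d)$ and $$\big\||\phi|^2\phi\big\|_{W^{-(s_c+\frac{\epsilon}{2}),r_\epsilon}}\le C\,\|\phi\|_{H^{s_\epsilon}}^3.$$ (ii) Let $d=2$ and $0<\epsilon<\frac29$. There is a constant $C=C(\epsilon)$ such that for every $\phi\in H^{1/3}(\mathbb R^2)$ the function $|\phi|^2\phi$ belongs to $W^{-(\frac13-\frac\epsilon2),r_\epsilon}(\mathbb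 R^2)$, where $r_\epsilon=\frac{2}{2-\epsilon}$, and $$\big\||\phi|^2\phi\big\|_{W^{-(\frac13-\frac{\epsilon}{2}),r_\epsilon}}\le C\,\|\phi\|_{H^{1/3}}^3.$$ -/

import Mathlib

open MeasureTheory
open scoped ENNReal NNReal SchwartzMap FourierTransform

namespace CubicSobolev

/-- `ℝ^d` with its Euclidean norm and Lebesgue measure. -/
abbrev Space (d : ℕ) : Type := EuclideanSpace ℝ (Fin d)

/-- The symbol `(1 + |2πξ|²)^(s/2)` of `(1 - Δ)^(s/2)`, for the Fourier transform
`𝓕 f ξ = ∫ exp(-2πi x·ξ) f x dx`. -/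
noncomputable def besselSymbol (d : ℕ) (s : ℝ) (ξ : Space d) : ℂ :=
  (((1 + ‖(2 * Real.pi) • ξ‖ ^ 2) ^ (s / 2) : ℝ) : ℂ)

/-- The symbol is smooth with derivatives of polynomial growth, so that the multiplier with this
symbol is the genuine one. -/
theorem besselSymbol_hasTemperateGrowth (d : ℕ) (s : ℝ) :
    (besselSymbol d s).HasTemperateGrowth := by
  have h1 : (fun ξ : Space d => (2 * Real.pi) • ξ).HasTemperateGrowth := by fun_prop
  have h2 := (Function.hasTemperateGrowth_one_add_norm_sq_rpow (Space d) (s / 2)).comp h1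
  have h3 : (fun ξ : Space d =>
      (((1 + ‖(2 * Real.pi) • ξ‖ ^ 2) ^ (s / 2) : ℝ) : ℂ)).HasTemperateGrowth := by
    have h2' : (fun ξ : Space d =>
      ((1 + ‖(2 * Real.pi) • ξ‖ ^ 2) ^ (s / 2) : ℝ)).HasTemperateGrowth := h2
    fun_prop
  exact h3

/-- The operator `(1 - Δ)^(s/2)` on the tempered distributions on `ℝ^d`. -/
noncomputable def bessel (d : ℕ) (s : ℝ) : 𝓢'(Space d, ℂ) →L[ℂ] 𝓢'(Space d, ℂ) :=
  TemperedDistribution.fourierMultiplierCLM ℂ (besselSymbol d s)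

/-- The tempered distribution `T` is given by the function `u`: for every Schwartz function `g`,
the integral `∫ g u` converges absolutely and equals `T g`. -/
def IsGivenBy {d : ℕ} (T : 𝓢'(Space d, ℂ)) (u : Space d → ℂ) : Prop :=
  ∀ g : 𝓢(Space d, ℂ), Integrable (fun x => g x * u x) ∧ T g = ∫ x, g x * u x

/-- `v` is the function `(1 - Δ)^(s/2) u`, in the sense of tempered distributions. -/
def IsBesselOf {d : ℕ} (s : ℝ) (u v : Space d → ℂ) : Prop :=
  ∃ T : 𝓢'(Space d, ℂ), IsGivenBy T u ∧ IsGivenBy (bessel d s T) v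

/-- The function `u` belongs to the Sobolev space `W^{s,p}(ℝ^d)`: it defines a tempered
distribution, and `(1 - Δ)^(s/2) u` is a function in `L^p`. -/
def MemW {d : ℕ} (s : ℝ) (p : ℝ≥0∞) (u : Space d → ℂ) : Prop :=
  ∃ v : Space d → ℂ, MemLp v p ∧ IsBesselOf s u v

/-- The norm `‖u‖_{W^{s,p}} = ‖(1 - Δ)^(s/2) u‖_{L^p}`, which is `∞` if `u ∉ W^{s,p}`. The function
`(1 - Δ)^(s/2) u` is determined almost everywhere, so the infimum is over one value at most. -/
noncomputable def normW {d : ℕ} (s : ℝ) (p : ℝ≥0∞) (u : Space d → ℂ) : ℝ≥0∞ :=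
  ⨅ (v : Space d → ℂ) (_ : MemLp v p ∧ IsBesselOf s u v), eLpNorm v p volume

/-- `u ∈ H^s = W^{s,2}`. -/
def MemH {d : ℕ} (s : ℝ) (u : Space d → ℂ) : Prop := MemW s 2 u

/-- The norm of `H^s = W^{s,2}`. -/
noncomputable def normH {d : ℕ} (s : ℝ) (u : Space d → ℂ) : ℝ≥0∞ := normW s 2 u

/-- The cubic nonlinearity `|φ|² φ`. -/
noncomputable def cubic {d : ℕ} (φ : Space d → ℂ) : Space d → ℂ :=
  fun x => ((‖φ x‖ ^ 2 : ℝ) : ℂ) * φ x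

/-- The critical regularity `s_c = d/2 - 1`. -/
noncomputable def sCrit (d : ℕ) : ℝ := (d : ℝ) / 2 - 1

/-- The real number `r_ε = 2d / (d + 2(1 - ε))`. -/
noncomputable def rExp (d : ℕ) (ε : ℝ) : ℝ := 2 * (d : ℝ) / ((d : ℝ) + 2 * (1 - ε))

end CubicSobolev

namespace CubicSobolev

/-! Both parts factor through a Lebesgue space: `H^s ⊂ L^(3q)` puts `|φ|²φ` in `L^q`, and `(1 -
Δ)^(-σ/2)` then maps `L^q` to `L^r`. With `z = 1/q`, the first embedding off its endpoint asks for
`1/2 - z/3 < s/d`, and the second map for `z - 1/r < σ/d`.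

For `d ≥ 3` these two strict inequalities leave an open interval of admissible `z`, so non-endpoint
estimates suffice. They follow from Young's inequality, because the Bessel kernel, a superposition
of heat kernels, lies in `L^m` whenever `1 - 1/m < s/d` (`lintegral_besselKernel_rpow_lt_top`,
`exists_besselConv_bound`).

For `d = 2`, `s = 1/3`, the conditions `q ≥ 1` and `3q ≤ 3` force `q = 1`, and `H^(1/3) ⊂ L^3` is
the critical Sobolev embedding, which Young's inequality misses. It is proved in
`exists_eLpNorm_le_of_isBesselOf_critical` by real interpolation by hand: at each height `t` the
frequencies are cut at a radius depending on `t` so that the low part is at most `t/2` pointwise.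
Chebyshev and Plancherel control the high part, and the layer-cake formula with Tonelli sums over
`t`. -/

/-! ### Young's convolution inequality. -/

/-- **Young's convolution inequality** for nonnegative functions on `ℝ^d`. -/
theorem lintegral_conv_rpow_le {d : ℕ} {k f : Space d → ℝ≥0∞} (hk : Measurable k)
    (hf : AEMeasurable f) {m q p : ℝ} (hm : 1 ≤ m) (hq : 1 ≤ q) (hp : 0 < p)
    (h : 1 / m + 1 / q = 1 + 1 / p) :
    ∫⁻ x, (∫⁻ y, k (x - y) * f y) ^ p ≤
      (∫⁻ x, k x ^ m) ^ (p / m) * (∫⁻ x, f x ^ q) ^ (p / q) := by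
  have hm0 : 0 < m := by linarith
  have hq0 : 0 < q := by linarith
  have h1q : 1 / q ≤ 1 := by rw [div_le_one hq0]; exact hq
  have h1m : 1 / m ≤ 1 := by rw [div_le_one hm0]; exact hm
  have hap : 0 < 1 / p := by positivity
  have ha : 0 ≤ 1 / m - 1 / p := by linarith
  have hb : 0 ≤ 1 / q - 1 / p := by linarith
  set A := ∫⁻ x, k x ^ m with hA
  set B := ∫⁻ x, f x ^ q with hB
  have key : ∀ x, (∫⁻ y, k (x - y) * f y) ^ p ≤
      (∫⁻ y, k (x - y) ^ m * f y ^ q) * (A ^ (p / m - 1) * B ^ (p / q - 1)) := by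
    intro x
    have hkx : Measurable fun y => k (x - y) := hk.comp (measurable_const.sub measurable_id)
    -- Hölder with three factors: the weights `1/p`, `1/m - 1/p`, `1/q - 1/p` are nonnegative and
    -- sum to 1 by the relation between the exponents.
    have hol0 := ENNReal.lintegral_prod_norm_pow_le (μ := (volume : Measure (Space d)))
      (Finset.univ : Finset (Fin 3))
      (f := ![fun y => k (x - y) ^ m * f y ^ q, fun y => k (x - y) ^ m, fun y => f y ^ q])
      (by
        intro i _
        fin_cases i
        · exact (hkx.pow_const _).aemeasurable.mul (hf.pow_const _)
        · exact (hkx.pow_const _).aemeasurable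
        · exact hf.pow_const _)
      (p := ![1 / p, 1 / m - 1 / p, 1 / q - 1 / p])
      (by simp [Fin.sum_univ_three]; simp at h; linarith)
      (by
        intro i _
        fin_cases i
        · exact hap.le
        · exact ha
        · exact hb)
    have hol : ∫⁻ y, (k (x - y) ^ m * f y ^ q) ^ (1 / p) * (k (x - y) ^ m) ^ (1 / m - 1 / p) *
        (f y ^ q) ^ (1 / q - 1 / p) ≤ (∫⁻ y, k (x - y) ^ m * f y ^ q) ^ (1 / p) *
        (∫⁻ y, k (x - y) ^ m) ^ (1 / m - 1 / p) * B ^ (1 / q - 1 / p) := by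
      simpa only [Fin.prod_univ_three] using! hol0
    have hA' : ∫⁻ y, k (x - y) ^ m = A := by
      rw [hA, lintegral_sub_left_eq_self (fun y => k y ^ m) x]
    rw [hA'] at hol
    have hpt : ∀ y, k (x - y) * f y = (k (x - y) ^ m * f y ^ q) ^ (1 / p) *
        (k (x - y) ^ m) ^ (1 / m - 1 / p) * (f y ^ q) ^ (1 / q - 1 / p) := by
      intro y
      rw [ENNReal.mul_rpow_of_nonneg _ _ hap.le]
      have e1 : k (x - y) = (k (x - y) ^ m) ^ (1 / p) * (k (x - y) ^ m) ^ (1 / m - 1 / p) := by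
        rw [← ENNReal.rpow_add_of_nonneg _ _ hap.le ha, ← ENNReal.rpow_mul]
        rw [show m * (1 / p + (1 / m - 1 / p)) = 1 by field_simp; ring, ENNReal.rpow_one]
      have e2 : f y = (f y ^ q) ^ (1 / p) * (f y ^ q) ^ (1 / q - 1 / p) := by
        rw [← ENNReal.rpow_add_of_nonneg _ _ hap.le hb, ← ENNReal.rpow_mul]
        rw [show q * (1 / p + (1 / q - 1 / p)) = 1 by field_simp; ring, ENNReal.rpow_one]
      conv_lhs => rw [e1, e2]
      ring
    simp_rw [hpt]
    calc _ ≤ _ := ENNReal.rpow_le_rpow hol hp.le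
      _ = _ := by
        rw [ENNReal.mul_rpow_of_nonneg _ _ hp.le, ENNReal.mul_rpow_of_nonneg _ _ hp.le,
          ← ENNReal.rpow_mul, ← ENNReal.rpow_mul, ← ENNReal.rpow_mul,
          show 1 / p * p = 1 by field_simp, ENNReal.rpow_one,
          show (1 / m - 1 / p) * p = p / m - 1 by field_simp,
          show (1 / q - 1 / p) * p = p / q - 1 by field_simp, mul_assoc]
  have hpm : 0 ≤ p / m - 1 := by
    have := mul_nonneg ha hp.le
    rwa [show (1 / m - 1 / p) * p = p / m - 1 by field_simp] at this
  have hpq : 0 ≤ p / q - 1 := by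
    have := mul_nonneg hb hp.le
    rwa [show (1 / q - 1 / p) * p = p / q - 1 by field_simp] at this
  have hmeas : AEMeasurable (fun z : Space d × Space d => k (z.1 - z.2) ^ m * f z.2 ^ q)
      (volume.prod volume) :=
    ((hk.comp (measurable_fst.sub measurable_snd)).pow_const _).aemeasurable.mul
      (hf.comp_snd.pow_const _)
  have tonelli : ∫⁻ x, ∫⁻ y, k (x - y) ^ m * f y ^ q = A * B := by
    rw [lintegral_lintegral_swap hmeas]
    have : ∀ y, ∫⁻ x, k (x - y) ^ m * f y ^ q = A * f y ^ q := by
      intro y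
      rw [lintegral_mul_const _ (by fun_prop), hA,
        lintegral_sub_right_eq_self (fun y => k y ^ m) y]
    simp_rw [this]
    rw [lintegral_const_mul'' _ (hf.pow_const _)]
  calc _ ≤ ∫⁻ x, (∫⁻ y, k (x - y) ^ m * f y ^ q) * (A ^ (p / m - 1) * B ^ (p / q - 1)) :=
        lintegral_mono key
    _ = A * B * (A ^ (p / m - 1) * B ^ (p / q - 1)) := by
        rw [lintegral_mul_const'' _ hmeas.lintegral_prod_right', tonelli]
    _ = (A ^ (1 : ℝ) * A ^ (p / m - 1)) * (B ^ (1 : ℝ) * B ^ (p / q - 1)) := by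
        simp only [ENNReal.rpow_one]; ring
    _ = _ := by
        rw [← ENNReal.rpow_add_of_nonneg _ _ zero_le_one hpm,
          ← ENNReal.rpow_add_of_nonneg _ _ zero_le_one hpq]
        simp

/-! ### The heat kernel and the Bessel kernel. -/

/-- The heat kernel at time `t`. -/
noncomputable def heatKernel (d : ℕ) (t : ℝ) (x : Space d) : ℝ :=
  (4 * Real.pi * t) ^ (-((d : ℝ) / 2)) * Real.exp (-(1 / (4 * t)) * ‖x‖ ^ 2)

theorem heatKernel_nonneg (d : ℕ) {t : ℝ} (ht : 0 < t) (x : Space d) : 0 ≤ heatKernel d t x := by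
  unfold heatKernel; positivity

theorem integral_heatKernel (d : ℕ) {t : ℝ} (ht : 0 < t) : ∫ x, heatKernel d t x = 1 := by
  have hb : 0 < 1 / (4 * t) := by positivity
  unfold heatKernel
  rw [integral_const_mul, GaussianFourier.integral_rexp_neg_mul_sq_norm hb, finrank_euclideanSpace,
    Fintype.card_fin, show Real.pi / (1 / (4 * t)) = 4 * Real.pi * t by field_simp,
    ← Real.rpow_add (by positivity)]
  simp

theorem integrable_heatKernel (d : ℕ) {t : ℝ} (ht : 0 < t) : Integrable (heatKernel d t) :=
  integrable_of_integral_eq_one (integral_heatKernel d ht)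

theorem fourier_heatKernel (d : ℕ) {t : ℝ} (ht : 0 < t) (ξ : Space d) :
    𝓕 (fun x => (heatKernel d t x : ℂ)) ξ
      = (Real.exp (-(4 * Real.pi ^ 2 * ‖ξ‖ ^ 2 * t)) : ℝ) := by
  have hb : 0 < ((1 / (4 * t) : ℝ) : ℂ).re := by rw [Complex.ofReal_re]; positivity
  have h1 : (fun x : Space d => (heatKernel d t x : ℂ)) =
      fun x => (((4 * Real.pi * t) ^ (-((d : ℝ) / 2)) : ℝ) : ℂ) •
        Complex.exp (-((1 / (4 * t) : ℝ) : ℂ) * ‖x‖ ^ 2) := by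
    ext x; unfold heatKernel; push_cast; rfl
  have h2 := fourier_gaussian_innerProductSpace (V := Space d) hb ξ
  rw [h1]
  have h3 : 𝓕 (fun x : Space d => (((4 * Real.pi * t) ^ (-((d : ℝ) / 2)) : ℝ) : ℂ) •
        Complex.exp (-((1 / (4 * t) : ℝ) : ℂ) * ‖x‖ ^ 2)) ξ =
      (((4 * Real.pi * t) ^ (-((d : ℝ) / 2)) : ℝ) : ℂ) •
        𝓕 (fun x : Space d => Complex.exp (-((1 / (4 * t) : ℝ) : ℂ) * ‖x‖ ^ 2)) ξ := by
    rw [Real.fourier_eq, Real.fourier_eq, ← integral_smul]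
    congr 1; ext x; rw [smul_comm]
  rw [h3, h2, finrank_euclideanSpace, Fintype.card_fin]
  have h4 : ((Real.pi : ℂ) / ((1 / (4 * t) : ℝ) : ℂ)) ^ ((d : ℂ) / 2) =
      (((4 * Real.pi * t) ^ ((d : ℝ) / 2) : ℝ) : ℂ) := by
    rw [Complex.ofReal_cpow (by positivity)]
    push_cast
    congr 1
    have : (t : ℂ) ≠ 0 := by exact_mod_cast ht.ne'
    field_simp
  rw [h4, smul_eq_mul, ← mul_assoc, ← Complex.ofReal_mul, ← Real.rpow_add (by positivity)]
  simp only [neg_add_cancel, Real.rpow_zero, Complex.ofReal_one, one_mul]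
  push_cast
  congr 1
  have : (t : ℂ) ≠ 0 := by exact_mod_cast ht.ne'
  field_simp

/-- The kernel of `(1 - Δ)^(-s/2)`, as a superposition of heat kernels. -/
noncomputable def besselKernel (d : ℕ) (s : ℝ) (x : Space d) : ℝ :=
  (Real.Gamma (s / 2))⁻¹ *
    ∫ t in Set.Ioi (0 : ℝ), Real.exp (-t) * t ^ (s / 2 - 1) * heatKernel d t x

theorem besselKernel_nonneg (d : ℕ) {s : ℝ} (hs : 0 < s) (x : Space d) :
    0 ≤ besselKernel d s x := by
  refine mul_nonneg (inv_nonneg.2 (Real.Gamma_pos_of_pos (by positivity)).le) ?_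
  refine setIntegral_nonneg measurableSet_Ioi fun t ht => ?_
  have := heatKernel_nonneg d ht x
  have ht' : (0 : ℝ) < t := ht
  positivity

theorem measurable_heatKernel (d : ℕ) :
    Measurable fun z : ℝ × Space d => heatKernel d z.1 z.2 := by
  unfold heatKernel
  fun_prop

theorem measurable_besselKernel (d : ℕ) (s : ℝ) : Measurable (besselKernel d s) := by
  unfold besselKernel
  refine Measurable.const_mul ?_ _
  have : Measurable fun z : Space d × ℝ =>
      Real.exp (-z.2) * z.2 ^ (s / 2 - 1) * heatKernel d z.2 z.1 :=
    Measurable.mul (by fun_prop) ((measurable_heatKernel d).comp measurable_swap)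
  exact (this.stronglyMeasurable.integral_prod_right').measurable

/-- Each heat kernel has mass 1, so integrating in `x` first leaves the convergent integral of
`Γ(s/2)`. This justifies Fubini for the kernel and its Fourier transform. -/
theorem integrable_besselKernel_prod (d : ℕ) {s : ℝ} (hs : 0 < s) :
    Integrable (fun z : ℝ × Space d => Real.exp (-z.1) * z.1 ^ (s / 2 - 1) * heatKernel d z.1 z.2)
      ((volume.restrict (Set.Ioi (0 : ℝ))).prod volume) := by
  have hmeas : Measurable fun z : ℝ × Space d =>
      Real.exp (-z.1) * z.1 ^ (s / 2 - 1) * heatKernel d z.1 z.2 :=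
    Measurable.mul (by fun_prop) (measurable_heatKernel d)
  rw [integrable_prod_iff hmeas.aestronglyMeasurable]
  constructor
  · filter_upwards [ae_restrict_mem measurableSet_Ioi] with t ht
    exact (integrable_heatKernel d ht).const_mul _
  · refine (Real.GammaIntegral_convergent (s := s / 2) (by positivity)).congr ?_
    filter_upwards [ae_restrict_mem measurableSet_Ioi] with t ht
    have ht' : (0 : ℝ) < t := ht
    have h1 : ∀ x, ‖Real.exp (-t) * t ^ (s / 2 - 1) * heatKernel d t x‖ =
        Real.exp (-t) * t ^ (s / 2 - 1) * heatKernel d t x := fun x => by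
      have := heatKernel_nonneg d ht x
      exact Real.norm_of_nonneg (by positivity)
    simp only [h1]
    rw [integral_const_mul, integral_heatKernel d ht, mul_one]

theorem integrable_besselKernel (d : ℕ) {s : ℝ} (hs : 0 < s) : Integrable (besselKernel d s) :=
  (integrable_besselKernel_prod d hs).integral_prod_right.const_mul _

/-- After Fubini, the heat kernel at time `t` contributes `exp(-4π²|ξ|²t)`, and the remaining
integral in `t` is a Gamma integral with rate `1 + 4π²|ξ|²`. -/
theorem fourier_besselKernel (d : ℕ) {s : ℝ} (hs : 0 < s) (ξ : Space d) :
    𝓕 (fun x => (besselKernel d s x : ℂ)) ξ = besselSymbol d (-s) ξ := by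
  have hint : Integrable (Function.uncurry fun (x : Space d) (t : ℝ) =>
      Real.fourierChar (-inner ℝ x ξ) •
        ((Real.exp (-t) * t ^ (s / 2 - 1) * heatKernel d t x : ℝ) : ℂ))
      (volume.prod (volume.restrict (Set.Ioi (0 : ℝ)))) := by
    have h := (integrable_besselKernel_prod d hs).swap.ofReal (𝕜 := ℂ)
    refine h.mono ?_ (Filter.Eventually.of_forall fun z => ?_)
    · refine AEStronglyMeasurable.smul ?_ h.aestronglyMeasurable
      have : Continuous fun z : Space d × ℝ => (Real.fourierChar (-inner ℝ z.1 ξ) : ℂ) := by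
        fun_prop
      exact this.aestronglyMeasurable
    · rw [Function.uncurry, Circle.smul_def, norm_smul, Circle.norm_coe, one_mul]
      exact le_rfl
  have hG : Real.Gamma (s / 2) ≠ 0 := (Real.Gamma_pos_of_pos (by positivity)).ne'
  calc 𝓕 (fun x => (besselKernel d s x : ℂ)) ξ
      = ((Real.Gamma (s / 2))⁻¹ : ℝ) • ∫ x : Space d, ∫ t in Set.Ioi (0 : ℝ),
          Real.fourierChar (-inner ℝ x ξ) •
            ((Real.exp (-t) * t ^ (s / 2 - 1) * heatKernel d t x : ℝ) : ℂ) := by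
        rw [Real.fourier_eq, ← integral_smul]
        congr 1; ext x
        simp only [Circle.smul_def]
        rw [integral_smul, integral_complex_ofReal, smul_comm, besselKernel, Complex.ofReal_mul,
          ← Complex.real_smul]
    _ = ((Real.Gamma (s / 2))⁻¹ : ℝ) • ∫ t in Set.Ioi (0 : ℝ), ∫ x : Space d,
          Real.fourierChar (-inner ℝ x ξ) •
            ((Real.exp (-t) * t ^ (s / 2 - 1) * heatKernel d t x : ℝ) : ℂ) := by
        rw [integral_integral_swap hint]
    _ = ((Real.Gamma (s / 2))⁻¹ : ℝ) • ∫ t in Set.Ioi (0 : ℝ),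
          ((t ^ (s / 2 - 1) * Real.exp (-((1 + 4 * Real.pi ^ 2 * ‖ξ‖ ^ 2) * t)) : ℝ) : ℂ) := by
        congr 1
        refine setIntegral_congr_fun measurableSet_Ioi fun t ht => ?_
        have h := fourier_heatKernel d ht ξ
        rw [Real.fourier_eq] at h
        have h2 : ∀ x : Space d, Real.fourierChar (-inner ℝ x ξ) •
            ((Real.exp (-t) * t ^ (s / 2 - 1) * heatKernel d t x : ℝ) : ℂ) =
            ((Real.exp (-t) * t ^ (s / 2 - 1) : ℝ) : ℂ) *
              (Real.fourierChar (-inner ℝ x ξ) • (heatKernel d t x : ℂ)) := fun x => by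
          simp only [Circle.smul_def, smul_eq_mul]; push_cast; ring
        simp only [h2]
        rw [integral_const_mul, h, ← Complex.ofReal_mul]
        congr 1
        rw [show -((1 + 4 * Real.pi ^ 2 * ‖ξ‖ ^ 2) * t) =
          -t + -(4 * Real.pi ^ 2 * ‖ξ‖ ^ 2 * t) by ring, Real.exp_add]
        ring
    _ = besselSymbol d (-s) ξ := by
        rw [integral_complex_ofReal, Real.integral_rpow_mul_exp_neg_mul_Ioi (by positivity)
          (by positivity), Complex.real_smul, ← Complex.ofReal_mul, besselSymbol]
        congr 1
        rw [norm_smul, Real.norm_of_nonneg (by positivity : (0 : ℝ) ≤ 2 * Real.pi),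
          show (2 * Real.pi * ‖ξ‖) ^ 2 = 4 * Real.pi ^ 2 * ‖ξ‖ ^ 2 by ring, one_div,
          Real.inv_rpow (by positivity), neg_div, Real.rpow_neg (by positivity)]
        field_simp

/-! ### Size and integrability of the Bessel kernel. -/

theorem exp_neg_le_rpow {b y : ℝ} (hb : 0 < b) (hy : 0 < y) :
    Real.exp (-y) ≤ b ^ b * y ^ (-b) := by
  have h1 : y / b ≤ Real.exp (y / b) := by linarith [Real.add_one_le_exp (y / b)]
  have h2 : (y / b) ^ b ≤ Real.exp y := by
    calc (y / b) ^ b ≤ Real.exp (y / b) ^ b := Real.rpow_le_rpow (by positivity) h1 hb.le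
      _ = Real.exp y := by rw [← Real.exp_mul]; congr 1; field_simp
  rw [Real.div_rpow hy.le hb.le, div_le_iff₀ (by positivity)] at h2
  rw [Real.exp_neg, Real.rpow_neg hy.le, ← div_eq_mul_inv, inv_eq_one_div,
    div_le_div_iff₀ (Real.exp_pos _) (by positivity)]
  linarith

/-- Trading the Gaussian for `(t/|x|²)^(a/2)` leaves the integral of `Γ((s - d + a)/2)`, which
converges exactly for `a > d - s`. One bound thus serves both ends: `a` just above `d - s` near the
origin, `a` large at infinity. -/
theorem besselKernel_le_rpow (d : ℕ) {s a : ℝ} (hs : 0 < s) (ha : 0 < a) (hda : (d : ℝ) - s < a) :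
    ∃ C : ℝ, 0 ≤ C ∧ ∀ x : Space d, x ≠ 0 → besselKernel d s x ≤ C * ‖x‖ ^ (-a) := by
  set c : ℝ := (4 * Real.pi) ^ (-((d : ℝ) / 2)) * ((a / 2) ^ (a / 2) * 4 ^ (a / 2)) with hc
  have hexp : 0 < (s - d + a) / 2 := by linarith
  refine ⟨(Real.Gamma (s / 2))⁻¹ * (c * Real.Gamma ((s - d + a) / 2)), ?_, fun x hx => ?_⟩
  · have := Real.Gamma_pos_of_pos hexp
    have := Real.Gamma_pos_of_pos (show 0 < s / 2 by positivity)
    positivity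
  have hx0 : 0 < ‖x‖ := norm_pos_iff.2 hx
  unfold besselKernel
  rw [mul_assoc]
  refine mul_le_mul_of_nonneg_left ?_
    (inv_nonneg.2 (Real.Gamma_pos_of_pos (by positivity)).le)
  have hconv := Real.GammaIntegral_convergent hexp
  have hle : ∀ t ∈ Set.Ioi (0 : ℝ), Real.exp (-t) * t ^ (s / 2 - 1) * heatKernel d t x ≤
      c * ‖x‖ ^ (-a) * (Real.exp (-t) * t ^ ((s - d + a) / 2 - 1)) := by
    intro t ht
    have ht' : (0 : ℝ) < t := ht
    have h1 : Real.exp (-(1 / (4 * t)) * ‖x‖ ^ 2) ≤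
        (a / 2) ^ (a / 2) * (4 ^ (a / 2) * t ^ (a / 2) * ‖x‖ ^ (-a)) := by
      have h := exp_neg_le_rpow (b := a / 2) (y := ‖x‖ ^ 2 / (4 * t)) (by positivity)
        (by positivity)
      convert h using 2
      · ring
      · rw [Real.div_rpow (by positivity) (by positivity), ← Real.rpow_natCast, ← Real.rpow_mul
          hx0.le, Real.mul_rpow (by norm_num) ht'.le, Real.rpow_neg zero_le_four,
          Real.rpow_neg ht'.le, show ((2 : ℕ) : ℝ) * -(a / 2) = -a by push_cast; ring]
        field_simp
    calc _ ≤ Real.exp (-t) * t ^ (s / 2 - 1) * ((4 * Real.pi * t) ^ (-((d : ℝ) / 2)) *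
          ((a / 2) ^ (a / 2) * (4 ^ (a / 2) * t ^ (a / 2) * ‖x‖ ^ (-a)))) := by
          unfold heatKernel; gcongr
      _ = _ := by
          rw [Real.mul_rpow (by positivity) ht'.le, hc,
            show (s - d + a) / 2 - 1 = (s / 2 - 1) + (-((d : ℝ) / 2)) + a / 2 by ring,
            Real.rpow_add ht', Real.rpow_add ht']
          ring
  calc _ ≤ ∫ t in Set.Ioi (0 : ℝ), c * ‖x‖ ^ (-a) *
        (Real.exp (-t) * t ^ ((s - d + a) / 2 - 1)) := by
        refine integral_mono_of_nonneg ?_ (hconv.const_mul _) ?_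
        · filter_upwards [ae_restrict_mem measurableSet_Ioi] with t ht
          have := heatKernel_nonneg d ht x
          have ht' : (0 : ℝ) < t := ht
          positivity
        · filter_upwards [ae_restrict_mem measurableSet_Ioi] with t ht
          exact hle t ht
    _ = _ := by
        rw [integral_const_mul, Real.Gamma_eq_integral hexp]; ring

theorem lintegral_ball_norm_rpow_lt_top {d : ℕ} (hd : 0 < d) {a : ℝ} (ha : a < d) :
    ∫⁻ x in Metric.ball (0 : Space d) 1, ENNReal.ofReal (‖x‖ ^ (-a)) < ∞ := by
  have : NeZero d := ⟨hd.ne'⟩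
  have h : IntegrableOn (fun x : Space d => ‖x‖ ^ (-a)) (Metric.ball 0 1) := by
    rw [integrableOn_fun_norm_addHaar (volume : Measure (Space d)) (f := fun y => y ^ (-a))]
    rw [finrank_euclideanSpace, Fintype.card_fin]
    have h1 : IntegrableOn (fun y : ℝ => y ^ ((d : ℝ) - 1 - a)) (Set.Ioo 0 1) := by
      rw [intervalIntegral.integrableOn_Ioo_rpow_iff one_pos]
      linarith
    refine h1.congr_fun (fun y hy => ?_) measurableSet_Ioo
    have hy0 : 0 < y := hy.1
    rw [smul_eq_mul, ← Real.rpow_natCast, ← Real.rpow_add hy0, Nat.cast_pred hd]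
    ring_nf
  exact h.lintegral_lt_top

theorem lintegral_compl_ball_norm_rpow_lt_top {d : ℕ} {b : ℝ} (hb : (d : ℝ) < b) :
    ∫⁻ x in (Metric.ball (0 : Space d) 1)ᶜ, ENNReal.ofReal (‖x‖ ^ (-b)) < ∞ := by
  have hb0 : 0 < b := lt_of_le_of_lt (Nat.cast_nonneg d) hb
  -- Outside the unit ball `1 + |x| ≤ 2|x|`, whence the factor `2^b`.
  have h1 : Integrable fun x : Space d => 2 ^ b * (1 + ‖x‖) ^ (-b) :=
    (integrable_one_add_norm (by simpa using hb)).const_mul _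
  refine lt_of_le_of_lt ?_ (h1.lintegral_lt_top)
  refine (setLIntegral_mono' measurableSet_ball.compl fun x hx => ?_).trans
    (setLIntegral_le_lintegral _ _)
  have hx1 : 1 ≤ ‖x‖ := by simpa using hx
  refine ENNReal.ofReal_le_ofReal ?_
  rw [Real.rpow_neg (by positivity), Real.rpow_neg (by positivity), ← div_eq_mul_inv,
    inv_eq_one_div, div_le_div_iff₀ (by positivity) (by positivity), one_mul,
    ← Real.mul_rpow (by norm_num) (by positivity)]
  exact Real.rpow_le_rpow (by positivity) (by linarith) hb0.le

/-- The Bessel kernel of order `s` lies in `L^m` for `m (d - s) < d`. -/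
theorem lintegral_besselKernel_rpow_lt_top {d : ℕ} (hd : 0 < d) {s m : ℝ} (hs : 0 < s)
    (hm : 1 ≤ m) (h : 1 - 1 / m < s / d) :
    ∫⁻ x, ENNReal.ofReal (besselKernel d s x) ^ m < ∞ := by
  have hm0 : 0 < m := by linarith
  have hd0 : (0 : ℝ) < d := by exact_mod_cast hd
  have hds : (d : ℝ) - s < d / m := by
    have := mul_lt_mul_of_pos_right h hd0
    rw [div_mul_cancel₀ _ hd0.ne'] at this
    have e : (1 - 1 / m) * d = d - d / m := by ring
    linarith
  -- `a > d - s` gives the pointwise bound, and `a < d/m` makes `|x|^(-am)` integrable at the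
  -- origin; the hypothesis on `m` leaves room between them.
  obtain ⟨a, ha1, ha2⟩ := exists_between (max_lt hds (show 0 < (d : ℝ) / m by positivity))
  have haS := (le_max_left _ _).trans_lt ha1
  have ha0 := (le_max_right _ _).trans_lt ha1
  have ham : a * m < d := by rwa [lt_div_iff₀ hm0] at ha2
  obtain ⟨C, hC0, hC⟩ := besselKernel_le_rpow d hs ha0 haS
  obtain ⟨C', hC0', hC'⟩ := besselKernel_le_rpow d (a := d + 1) hs (by positivity) (by linarith)
  have hbm : (d : ℝ) < (d + 1) * m := by nlinarith
  have bound : ∀ (c e : ℝ) (x : Space d), 0 ≤ c → besselKernel d s x ≤ c * ‖x‖ ^ (-e) →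
      ENNReal.ofReal (besselKernel d s x) ^ m ≤
        ENNReal.ofReal (c ^ m) * ENNReal.ofReal (‖x‖ ^ (-(e * m))) := by
    intro c e x hc hx
    rw [ENNReal.ofReal_rpow_of_nonneg (besselKernel_nonneg d hs x) hm0.le,
      ← ENNReal.ofReal_mul (by positivity)]
    refine ENNReal.ofReal_le_ofReal ?_
    refine (Real.rpow_le_rpow (besselKernel_nonneg d hs x) hx hm0.le).trans_eq ?_
    rw [Real.mul_rpow hc (by positivity), ← Real.rpow_mul (norm_nonneg _)]
    ring_nf
  have hne : ∀ᵐ x : Space d, x ≠ 0 := by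
    have : NeZero d := ⟨hd.ne'⟩
    exact Measure.ae_ne volume 0
  rw [← lintegral_add_compl _ (measurableSet_ball (x := (0 : Space d)) (ε := 1))]
  refine ENNReal.add_lt_top.2 ⟨?_, ?_⟩
  · refine lt_of_le_of_lt (lintegral_mono_ae (g := fun x => ENNReal.ofReal (C ^ m) *
      ENNReal.ofReal (‖x‖ ^ (-(a * m)))) ?_) ?_
    · filter_upwards [ae_restrict_of_ae hne] with x hx
      exact bound C a x hC0 (hC x hx)
    · rw [lintegral_const_mul' _ _ ENNReal.ofReal_ne_top]
      exact ENNReal.mul_lt_top ENNReal.ofReal_lt_top (lintegral_ball_norm_rpow_lt_top hd ham)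
  · refine lt_of_le_of_lt (lintegral_mono_ae (g := fun x => ENNReal.ofReal (C' ^ m) *
      ENNReal.ofReal (‖x‖ ^ (-((d + 1) * m)))) ?_) ?_
    · filter_upwards [ae_restrict_of_ae hne] with x hx
      exact bound C' _ x hC0' (hC' x hx)
    · rw [lintegral_const_mul' _ _ ENNReal.ofReal_ne_top]
      exact ENNReal.mul_lt_top ENNReal.ofReal_lt_top (lintegral_compl_ball_norm_rpow_lt_top hbm)

/-! ### Tempered distributions given by functions. -/

/-- Testing against a smooth bump equal to 1 near a point gives integrability there. -/
theorem IsGivenBy.locallyIntegrable {d : ℕ} {T : 𝓢'(Space d, ℂ)} {u : Space d → ℂ}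
    (h : IsGivenBy T u) : LocallyIntegrable u := by
  intro x
  let b : ContDiffBump x := ⟨1, 2, one_pos, one_lt_two⟩
  have hc : HasCompactSupport (Complex.ofRealCLM ∘ b) := b.hasCompactSupport.comp_left rfl
  have hs : ContDiff ℝ (⊤ : ℕ∞) (Complex.ofRealCLM ∘ b) :=
    Complex.ofRealCLM.contDiff.comp b.contDiff
  have hi := (h (hc.toSchwartzMap hs)).1
  refine ⟨Metric.closedBall x 1, Metric.closedBall_mem_nhds x one_pos, ?_⟩
  refine hi.integrableOn.congr_fun (fun y hy => ?_) Metric.isClosed_closedBall.measurableSet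
  have : b y = 1 := b.one_of_mem_closedBall hy
  simp [this]

theorem IsGivenBy.aestronglyMeasurable {d : ℕ} {T : 𝓢'(Space d, ℂ)} {u : Space d → ℂ}
    (h : IsGivenBy T u) : AEStronglyMeasurable u :=
  h.locallyIntegrable.aestronglyMeasurable

/-- The function that gives a tempered distribution is unique almost everywhere. -/
theorem IsGivenBy.ae_eq {d : ℕ} {T : 𝓢'(Space d, ℂ)} {u v : Space d → ℂ}
    (hu : IsGivenBy T u) (hv : IsGivenBy T v) : u =ᵐ[volume] v := by
  refine ae_eq_of_integral_contDiff_smul_eq hu.locallyIntegrable hv.locallyIntegrable ?_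
  intro g hg hgc
  have hc : HasCompactSupport (Complex.ofRealCLM ∘ g) := hgc.comp_left rfl
  have hs : ContDiff ℝ (⊤ : ℕ∞) (Complex.ofRealCLM ∘ g) := Complex.ofRealCLM.contDiff.comp hg
  have h1 := (hu (hc.toSchwartzMap hs)).2
  rw [(hv (hc.toSchwartzMap hs)).2] at h1
  simpa [Complex.real_smul] using h1.symm

theorem IsGivenBy.congr_ae {d : ℕ} {T : 𝓢'(Space d, ℂ)} {u v : Space d → ℂ}
    (hu : IsGivenBy T u) (huv : u =ᵐ[volume] v) : IsGivenBy T v := by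
  intro g
  have h : (fun x => g x * u x) =ᵐ[volume] fun x => g x * v x := by
    filter_upwards [huv] with x hx
    rw [hx]
  exact ⟨(hu g).1.congr h, (hu g).2.trans (integral_congr_ae h)⟩

theorem IsGivenBy.unique {d : ℕ} {S T : 𝓢'(Space d, ℂ)} {u : Space d → ℂ}
    (hS : IsGivenBy S u) (hT : IsGivenBy T u) : S = T := by
  ext g
  rw [(hS g).2, (hT g).2]

theorem IsGivenBy.add {d : ℕ} {S T : 𝓢'(Space d, ℂ)} {u v : Space d → ℂ}
    (hS : IsGivenBy S u) (hT : IsGivenBy T v) : IsGivenBy (S + T) (u + v) := by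
  intro g
  have e : (fun x => g x * (u + v) x) = fun x => g x * u x + g x * v x := by
    ext x; simp [mul_add]
  rw [e]
  refine ⟨(hS g).1.add (hT g).1, ?_⟩
  rw [integral_add (hS g).1 (hT g).1, ← (hS g).2, ← (hT g).2]
  rfl

theorem isGivenBy_Lp {d : ℕ} {p : ℝ≥0∞} [hp : Fact (1 ≤ p)]
    (f : Lp ℂ p (volume : Measure (Space d))) :
    IsGivenBy (Lp.toTemperedDistribution f) f := by
  intro g
  have : p.HolderConjugate (1 - p⁻¹)⁻¹ := ENNReal.HolderConjugate.inv_one_sub_inv' hp.out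
  refine ⟨?_, by simp⟩
  exact (g.memLp (1 - p⁻¹)⁻¹ volume).integrable_mul (Lp.memLp f)

theorem isGivenBy_toLp {d : ℕ} {p : ℝ≥0∞} [hp : Fact (1 ≤ p)] {u : Space d → ℂ} (hu : MemLp u p) :
    IsGivenBy (Lp.toTemperedDistribution (hu.toLp u)) u :=
  (isGivenBy_Lp _).congr_ae hu.coeFn_toLp

theorem bessel_neg_bessel {d : ℕ} (s : ℝ) (T : 𝓢'(Space d, ℂ)) :
    bessel d (-s) (bessel d s T) = T := by
  unfold bessel
  rw [TemperedDistribution.fourierMultiplierCLM_fourierMultiplierCLM_apply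
    (besselSymbol_hasTemperateGrowth d s) (besselSymbol_hasTemperateGrowth d (-s))]
  have : besselSymbol d s * besselSymbol d (-s) = fun _ => (1 : ℂ) := by
    ext ξ
    rw [Pi.mul_apply, besselSymbol, besselSymbol, ← Complex.ofReal_mul,
      ← Real.rpow_add (by positivity)]
    ring_nf
    simp
  rw [this]
  simp

/-! ### The Bessel potential as a convolution on `L^q`. -/

/-- On Schwartz functions `(1 - Δ)^(-s/2)` is the convolution with the Bessel kernel. -/
theorem fourier_besselSymbol_smul_fourierInv {d : ℕ} {s : ℝ} (hs : 0 < s) (g : 𝓢(Space d, ℂ))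
    (x : Space d) :
    𝓕 (SchwartzMap.smulLeftCLM ℂ (besselSymbol d (-s)) (𝓕⁻ g)) x =
      ∫ y, (besselKernel d s (y - x) : ℂ) * g y := by
  -- `G` is a modulation of `𝓕⁻ g`, so its transform is a translate of `g`. The identity is then the
  -- multiplication formula for the pair of the kernel and `G`.
  let G : Space d → ℂ := fun ξ => Real.fourierChar (-inner ℝ ξ x) • (𝓕⁻ g : 𝓢(Space d, ℂ)) ξ
  have hG : Integrable G :=
    (Real.fourierIntegral_convergent_iff x).2 (𝓕⁻ g).integrable
  have hF : ∀ y, 𝓕 G y = g (y + x) := by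
    intro y
    have h1 : g (y + x) = 𝓕 (𝓕⁻ g) (y + x) := by rw [FourierTransform.fourier_fourierInv_eq]
    rw [h1, SchwartzMap.fourier_coe, Real.fourier_eq, Real.fourier_eq]
    congr 1; ext ξ
    rw [smul_smul, ← AddChar.map_add_eq_mul, inner_add_right, neg_add]
  have key := VectorFourier.integral_fourierIntegral_smul_eq_flip (L := innerₗ (Space d))
    (μ := volume) (ν := volume)
    Real.continuous_fourierChar continuous_inner (integrable_besselKernel d hs).ofReal hG
  have key' : ∫ ξ, 𝓕 (fun x => (besselKernel d s x : ℂ)) ξ • G ξ =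
      ∫ y, (besselKernel d s y : ℂ) • 𝓕 G y := by
    simpa using! key
  simp_rw [hF, fourier_besselKernel d hs] at key'
  rw [SchwartzMap.fourier_coe, Real.fourier_eq,
    ← integral_add_right_eq_self (fun y => (besselKernel d s (y - x) : ℂ) * g y) x]
  simp only [add_sub_cancel_right]
  simp only [smul_eq_mul] at key'
  rw [← key']
  congr 1; ext ξ
  rw [SchwartzMap.smulLeftCLM_apply_apply (besselSymbol_hasTemperateGrowth d (-s)), smul_eq_mul,
    mul_smul_comm]

/-- The convolution with the Bessel kernel. -/
noncomputable def besselConv {d : ℕ} (s : ℝ) (f : Space d → ℂ) (x : Space d) : ℂ :=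
  ∫ y, (besselKernel d s (x - y) : ℂ) * f y

/-- The absolute values stand inside the convolution, so the estimate yields both the norm bound and
the absolute convergence needed for Fubini. -/
theorem exists_lintegral_besselKernel_conv_le {d : ℕ} (hd : 0 < d) {s q p : ℝ} (hs : 0 < s)
    (hq : 1 ≤ q) (hqp : q ≤ p) (h : 1 / q - 1 / p < s / d) :
    ∃ C : ℝ≥0, ∀ f : Space d → ℂ, AEStronglyMeasurable f →
      (∫⁻ x, (∫⁻ y, ENNReal.ofReal (besselKernel d s (x - y)) * ‖f y‖ₑ) ^ p) ^ (1 / p) ≤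
        C * eLpNorm f (ENNReal.ofReal q) volume := by
  have hq0 : 0 < q := by linarith
  have hp0 : 0 < p := by linarith
  have h1 : 1 / p ≤ 1 / q := one_div_le_one_div_of_le hq0 hqp
  have h2 : 1 / q ≤ 1 := by rw [div_le_one hq0]; exact hq
  have h3 : 0 < 1 / p := by positivity
  -- The exponent that Young's inequality dictates for the kernel; `1 - 1/m = 1/q - 1/p < s/d` is
  -- its integrability condition.
  set m : ℝ := 1 / (1 - (1 / q - 1 / p)) with hm
  have hm1 : 1 / m = 1 - (1 / q - 1 / p) := by rw [hm, one_div_one_div]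
  have hm' : 1 ≤ m := by
    rw [hm, le_div_iff₀ (by linarith)]; linarith
  have hK := lintegral_besselKernel_rpow_lt_top hd hs hm' (by rw [hm1]; linarith)
  refine ⟨((∫⁻ x, ENNReal.ofReal (besselKernel d s x) ^ m) ^ (1 / m)).toNNReal, fun f hf => ?_⟩
  have hY := lintegral_conv_rpow_le
    (k := fun x => ENNReal.ofReal (besselKernel d s x)) (f := fun x => ‖f x‖ₑ)
    (measurable_besselKernel d s).ennreal_ofReal hf.enorm hm' hq hp0 (by rw [hm1]; ring)
  rw [ENNReal.coe_toNNReal (ENNReal.rpow_ne_top_of_nonneg (by positivity) hK.ne),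
    eLpNorm_eq_lintegral_rpow_enorm_toReal (by simpa using hq0) ENNReal.ofReal_ne_top,
    ENNReal.toReal_ofReal hq0.le]
  refine (ENNReal.rpow_le_rpow hY h3.le).trans_eq ?_
  rw [ENNReal.mul_rpow_of_nonneg _ _ h3.le, ← ENNReal.rpow_mul, ← ENNReal.rpow_mul]
  congr 2 <;> field_simp

/-- The Bessel potential `(1 - Δ)^(-s/2)` maps `L^q` to `L^p` off the endpoint, and it is the
convolution with the Bessel kernel. -/
theorem exists_besselConv_bound {d : ℕ} (hd : 0 < d) {s q p : ℝ} (hs : 0 < s) (hq : 1 ≤ q)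
    (hqp : q ≤ p) (hp : 1 < p) (h : 1 / q - 1 / p < s / d) :
    ∃ C : ℝ≥0, ∀ f : Space d → ℂ, MemLp f (ENNReal.ofReal q) →
      MemLp (besselConv s f) (ENNReal.ofReal p) ∧
      eLpNorm (besselConv s f) (ENNReal.ofReal p) volume
        ≤ C * eLpNorm f (ENNReal.ofReal q) volume ∧
      ∀ T : 𝓢'(Space d, ℂ), IsGivenBy T f → IsGivenBy (bessel d (-s) T) (besselConv s f) := by
  obtain ⟨C, hC⟩ := exists_lintegral_besselKernel_conv_le hd hs hq hqp h
  have hp0 : 0 < p := by linarith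
  refine ⟨C, fun f hf => ?_⟩
  have hfm := hf.aestronglyMeasurable
  have hKm : Measurable fun z : Space d × Space d => besselKernel d s (z.1 - z.2) :=
    (measurable_besselKernel d s).comp (measurable_fst.sub measurable_snd)
  have hprod : AEStronglyMeasurable (fun z : Space d × Space d =>
      (besselKernel d s (z.1 - z.2) : ℂ) * f z.2) (volume.prod volume) :=
    (Complex.measurable_ofReal.comp hKm).aestronglyMeasurable.mul hfm.comp_snd
  have hen : ∀ x y : Space d, ‖(besselKernel d s (x - y) : ℂ) * f y‖ₑ =
      ENNReal.ofReal (besselKernel d s (x - y)) * ‖f y‖ₑ := fun x y => by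
    rw [enorm_mul, ← ofReal_norm, Complex.norm_real,
      Real.norm_of_nonneg (besselKernel_nonneg d hs _)]
  have hbd : eLpNorm (besselConv s f) (ENNReal.ofReal p) volume
        ≤ C * eLpNorm f (ENNReal.ofReal q) volume := by
    refine le_trans ?_ (hC f hfm)
    rw [eLpNorm_eq_lintegral_rpow_enorm_toReal (by simpa using hp0) ENNReal.ofReal_ne_top,
      ENNReal.toReal_ofReal hp0.le]
    refine ENNReal.rpow_le_rpow (lintegral_mono fun x => ENNReal.rpow_le_rpow ?_ hp0.le)
      (by positivity)
    refine (enorm_integral_le_lintegral_enorm _).trans_eq ?_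
    simp_rw [hen]
  refine ⟨⟨hprod.integral_prod_right', hbd.trans_lt
    (ENNReal.mul_lt_top ENNReal.coe_lt_top hf.eLpNorm_lt_top)⟩, hbd, fun T hT g => ?_⟩
  -- Hölder pairs `g` in the conjugate exponent of `p` with the convolution of absolute values in
  -- `L^p`.
  have hfub : Integrable (fun z : Space d × Space d =>
      g z.1 * ((besselKernel d s (z.1 - z.2) : ℂ) * f z.2)) (volume.prod volume) := by
    have hgm : AEStronglyMeasurable (fun z : Space d × Space d => g z.1) (volume.prod volume) :=
      (g.continuous.comp continuous_fst).aestronglyMeasurable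
    have hgp : AEStronglyMeasurable (fun z : Space d × Space d =>
        g z.1 * ((besselKernel d s (z.1 - z.2) : ℂ) * f z.2)) (volume.prod volume) :=
      hgm.mul hprod
    refine ⟨hgp, ?_⟩
    rw [hasFiniteIntegral_iff_enorm, lintegral_prod _ hgp.enorm]
    have hconj := Real.HolderConjugate.conjExponent hp
    have hw : AEMeasurable fun x : Space d =>
        ∫⁻ y, ENNReal.ofReal (besselKernel d s (x - y)) * ‖f y‖ₑ := by
      have := hprod.enorm.lintegral_prod_right'
      simpa only [hen] using this
    have hg := g.memLp (ENNReal.ofReal p.conjExponent) volume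
    have hg' : (∫⁻ x, ‖g x‖ₑ ^ p.conjExponent) ^ (1 / p.conjExponent) < ∞ := by
      have := hg.eLpNorm_lt_top
      rwa [eLpNorm_eq_lintegral_rpow_enorm_toReal (by simpa using hconj.symm.pos)
        ENNReal.ofReal_ne_top, ENNReal.toReal_ofReal hconj.symm.nonneg] at this
    have hol := ENNReal.lintegral_mul_le_Lp_mul_Lq volume hconj hw
      g.continuous.aestronglyMeasurable.enorm
    refine lt_of_le_of_lt (le_trans (le_of_eq ?_) hol) (ENNReal.mul_lt_top
      ((hC f hfm).trans_lt (ENNReal.mul_lt_top ENNReal.coe_lt_top hf.eLpNorm_lt_top)) hg')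
    refine lintegral_congr fun x => ?_
    simp only [enorm_mul, Pi.mul_apply]
    rw [lintegral_const_mul' _ _ enorm_ne_top, mul_comm]
    simp_rw [← hen, enorm_mul]
  have e1 : (fun x => g x * besselConv s f x) =
      fun x => ∫ y, g x * ((besselKernel d s (x - y) : ℂ) * f y) := by
    ext x; rw [integral_const_mul]; rfl
  rw [e1]
  refine ⟨hfub.integral_prod_left, ?_⟩
  rw [integral_integral_swap hfub]
  unfold bessel
  -- The multiplier is moved onto the test function, where it is already known to be a convolution
  -- with the kernel.
  rw [TemperedDistribution.fourierMultiplierCLM_apply_apply, (hT _).2]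
  congr 1; ext y
  rw [fourier_besselSymbol_smul_fourierInv hs, ← integral_mul_const]
  congr 1; ext x
  ring

/-- A function with `(1 - Δ)^(s/2) u ∈ L^q` lies in `L^p` off the endpoint. -/
theorem exists_eLpNorm_le_of_isBesselOf {d : ℕ} (hd : 0 < d) {s q p : ℝ} (hs : 0 < s) (hq : 1 ≤ q)
    (hqp : q ≤ p) (hp : 1 < p) (h : 1 / q - 1 / p < s / d) :
    ∃ C : ℝ≥0, ∀ u v : Space d → ℂ, IsBesselOf s u v → MemLp v (ENNReal.ofReal q) →
      eLpNorm u (ENNReal.ofReal p) volume ≤ C * eLpNorm v (ENNReal.ofReal q) volume := by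
  obtain ⟨C, hC⟩ := exists_besselConv_bound hd hs hq hqp hp h
  refine ⟨C, fun u v ⟨T, hu, hv⟩ hvq => ?_⟩
  obtain ⟨-, h2, h3⟩ := hC v hvq
  have := h3 _ hv
  rw [bessel_neg_bessel] at this
  rwa [eLpNorm_congr_ae (hu.ae_eq this)]

/-! ### Frequency splitting and the critical Sobolev embedding. -/

/-- The inverse Fourier transform, in the sense of distributions, of an integrable function is
given by the inverse Fourier integral. -/
theorem isGivenBy_fourierInv_of_integrable {d : ℕ} {S : 𝓢'(Space d, ℂ)} {w : Space d → ℂ}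
    (hw : Integrable w) (hS : IsGivenBy S w) : IsGivenBy (𝓕⁻ S) (𝓕⁻ w) := by
  have hneg : Integrable fun ξ => w (-ξ) := hw.comp_neg
  have hcont : Continuous (𝓕⁻ w) := by
    rw [Real.fourierInv_eq_fourier_comp_neg]
    exact VectorFourier.fourierIntegral_continuous (L := innerₗ (Space d))
      Real.continuous_fourierChar continuous_inner hneg
  have hbd : ∀ x, ‖(𝓕⁻ w) x‖ ≤ ∫ ξ, ‖w (-ξ)‖ := fun x => by
    rw [Real.fourierInv_eq_fourier_comp_neg]
    exact VectorFourier.norm_fourierIntegral_le_integral_norm _ _ _ _ _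
  intro g
  refine ⟨g.integrable.mul_bdd hcont.aestronglyMeasurable (Filter.Eventually.of_forall hbd), ?_⟩
  rw [TemperedDistribution.fourierInv_apply, (hS _).2, SchwartzMap.fourierInv_coe]
  have key := VectorFourier.integral_fourierIntegral_smul_eq_flip (L := innerₗ (Space d))
    (μ := volume) (ν := volume)
    Real.continuous_fourierChar continuous_inner g.integrable hneg
  have key' : ∫ ξ, 𝓕 (g : Space d → ℂ) ξ • w (-ξ) =
      ∫ x, g x • 𝓕 (fun ξ => w (-ξ)) x := by
    simpa using! key
  simp only [smul_eq_mul] at key'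
  rw [Real.fourierInv_eq_fourier_comp_neg w, ← key']
  refine (integral_neg_eq_self
    (fun x : Space d => 𝓕⁻ (g : Space d → ℂ) x * w x) volume).symm.trans ?_
  simp only [Real.fourierInv_eq_fourier_neg, neg_neg]

theorem eLpNorm_two_sq {d : ℕ} (f : Space d → ℂ) :
    eLpNorm f 2 volume ^ 2 = ∫⁻ x, ‖f x‖ₑ ^ 2 := by
  rw [← ENNReal.rpow_natCast, eLpNorm_eq_lintegral_rpow_enorm_toReal two_ne_zero
    ENNReal.ofNat_ne_top, ← ENNReal.rpow_mul]
  simp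

/-- Splitting a distribution with square integrable Fourier transform into the parts with frequency
in `A` and outside `A`. -/
theorem exists_frequency_split {d : ℕ} {T : 𝓢'(Space d, ℂ)} {W : Space d → ℂ}
    (hT : IsGivenBy (𝓕 T) W) (hW : MemLp W 2) {A : Set (Space d)} (hA : MeasurableSet A)
    (hWA : IntegrableOn W A) :
    ∃ a b : Space d → ℂ, IsGivenBy T (a + b) ∧ (∀ x, ‖a x‖ₑ ≤ ∫⁻ ξ in A, ‖W ξ‖ₑ) ∧
      AEStronglyMeasurable b ∧ ∫⁻ x, ‖b x‖ₑ ^ 2 = ∫⁻ ξ in Aᶜ, ‖W ξ‖ₑ ^ 2 := by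
  have h1 : Integrable (A.indicator W) := (integrable_indicator_iff hA).2 hWA
  have h1' : MemLp (A.indicator W) 1 := memLp_one_iff_integrable.2 h1
  have h2 : MemLp (Aᶜ.indicator W) 2 := hW.indicator hA.compl
  have hg1 := isGivenBy_toLp h1'
  have hg2 := isGivenBy_toLp h2
  have hsum : 𝓕 T = Lp.toTemperedDistribution (h1'.toLp _) +
      Lp.toTemperedDistribution (h2.toLp _) := by
    refine hT.unique ?_
    have := hg1.add hg2
    rwa [Set.indicator_self_add_compl] at this
  have hT' : T = 𝓕⁻ (Lp.toTemperedDistribution (h1'.toLp _)) +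
      Lp.toTemperedDistribution (𝓕⁻ (h2.toLp _)) := by
    rw [← Lp.fourierInv_toTemperedDistribution_eq, ← FourierTransform.fourierInv_add, ← hsum,
      FourierTransform.fourierInv_fourier_eq]
  refine ⟨𝓕⁻ (A.indicator W), (𝓕⁻ (h2.toLp _) : Lp ℂ 2 (volume : Measure (Space d))), ?_, ?_,
    Lp.aestronglyMeasurable _, ?_⟩
  · rw [hT']
    exact (isGivenBy_fourierInv_of_integrable h1 hg1).add (isGivenBy_Lp _)
  · intro x
    rw [Real.fourierInv_eq]
    refine (enorm_integral_le_lintegral_enorm _).trans_eq ?_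
    rw [← lintegral_indicator hA]
    refine lintegral_congr fun ξ => ?_
    rw [Circle.smul_def, enorm_smul, ← ofReal_norm (_ : ℂ), Circle.norm_coe, ENNReal.ofReal_one,
      one_mul, enorm_indicator_eq_indicator_enorm]
  · have hn : ‖(𝓕⁻ (h2.toLp _) : Lp ℂ 2 (volume : Measure (Space d)))‖ₑ = ‖h2.toLp _‖ₑ := by
      rw [← ofReal_norm, ← ofReal_norm, ← Lp.norm_fourier_eq (𝓕⁻ (h2.toLp _)),
        FourierTransform.fourier_fourierInv_eq]
    rw [Lp.enorm_def, Lp.enorm_def, eLpNorm_congr_ae h2.coeFn_toLp] at hn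
    rw [← eLpNorm_two_sq, hn, eLpNorm_two_sq, ← lintegral_indicator hA.compl]
    refine lintegral_congr fun ξ => ?_
    rw [enorm_indicator_eq_indicator_enorm]
    by_cases h : ξ ∈ Aᶜ <;> simp [h]

/-- The distribution function of `u` is controlled by the high frequencies, if the low frequencies
are small in `L^1`. -/
theorem meas_lt_enorm_le {d : ℕ} {T : 𝓢'(Space d, ℂ)} {u W : Space d → ℂ}
    (hu : IsGivenBy T u) (hT : IsGivenBy (𝓕 T) W) (hW : MemLp W 2) {A : Set (Space d)}
    (hA : MeasurableSet A) {t : ℝ} (ht : 0 < t)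
    (hWA : ∫⁻ ξ in A, ‖W ξ‖ₑ ≤ ENNReal.ofReal (t / 2)) :
    volume {x | t < ‖u x‖} ≤ ENNReal.ofReal (4 / t ^ 2) * ∫⁻ ξ in Aᶜ, ‖W ξ‖ₑ ^ 2 := by
  have hint : IntegrableOn W A :=
    ⟨hW.aestronglyMeasurable.restrict, hWA.trans_lt ENNReal.ofReal_lt_top⟩
  obtain ⟨a, b, hab, ha, hbm, hb⟩ := exists_frequency_split hT hW hA hint
  have hae := hu.ae_eq hab
  calc volume {x | t < ‖u x‖}
      ≤ volume {x | ENNReal.ofReal ((t / 2) ^ 2) ≤ ‖b x‖ₑ ^ 2} := by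
        -- Where `|u| > t` and the low part is at most `t/2`, the high part must exceed `t/2`.
        refine measure_mono_ae ?_
        filter_upwards [hae] with x hx htx
        have htx' : t < ‖u x‖ := htx
        have h1 : ‖a x‖ ≤ t / 2 := by
          have := (ha x).trans hWA
          rwa [← ofReal_norm, ENNReal.ofReal_le_ofReal_iff (by positivity)] at this
        have h2 : ‖u x‖ ≤ ‖a x‖ + ‖b x‖ := by rw [hx]; exact norm_add_le _ _
        change ENNReal.ofReal ((t / 2) ^ 2) ≤ ‖b x‖ₑ ^ 2
        rw [← ofReal_norm, ← ENNReal.ofReal_pow (norm_nonneg _)]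
        refine ENNReal.ofReal_le_ofReal (pow_le_pow_left₀ (by positivity) (by linarith) 2)
    _ ≤ (∫⁻ x, ‖b x‖ₑ ^ 2) / ENNReal.ofReal ((t / 2) ^ 2) :=
        meas_ge_le_lintegral_div (hbm.enorm.pow_const 2) (by simpa using by positivity)
          ENNReal.ofReal_ne_top
    _ = _ := by
        rw [hb, ENNReal.div_eq_inv_mul, ← ENNReal.ofReal_inv_of_pos (by positivity)]
        congr 2
        field_simp
        norm_num

/-- `V` is the Plancherel transform of `v`. The transform of `u` thus becomes an actual function, a
decaying weight times an `L^2` function of the same norm as `v`. -/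
theorem exists_fourier_of_isBesselOf {d : ℕ} {s : ℝ} {u v : Space d → ℂ} (h : IsBesselOf s u v)
    (hv : MemLp v 2) :
    ∃ (T : 𝓢'(Space d, ℂ)) (V : Space d → ℂ), IsGivenBy T u ∧
      IsGivenBy (𝓕 T) (fun ξ => besselSymbol d (-s) ξ * V ξ) ∧ MemLp V 2 ∧
      eLpNorm V 2 volume = eLpNorm v 2 volume := by
  obtain ⟨T, hu, hT⟩ := h
  refine ⟨T, (𝓕 (hv.toLp v) : Lp ℂ 2 (volume : Measure (Space d))), hu, ?_, Lp.memLp _, ?_⟩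
  · have e1 : bessel d s T = Lp.toTemperedDistribution (hv.toLp v) := hT.unique (isGivenBy_toLp hv)
    have e2 : 𝓕 T = TemperedDistribution.smulLeftCLM ℂ (besselSymbol d (-s))
        (Lp.toTemperedDistribution (𝓕 (hv.toLp v))) := by
      conv_lhs => rw [← bessel_neg_bessel s T, e1]
      rw [← Lp.fourier_toTemperedDistribution_eq, bessel,
        TemperedDistribution.fourierMultiplierCLM_apply, FourierTransform.fourier_fourierInv_eq]
    intro g
    have hg := isGivenBy_Lp (𝓕 (hv.toLp v)) (SchwartzMap.smulLeftCLM ℂ (besselSymbol d (-s)) g)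
    have e3 : ∀ ξ, (SchwartzMap.smulLeftCLM ℂ (besselSymbol d (-s)) g) ξ *
        (𝓕 (hv.toLp v) : Lp ℂ 2 (volume : Measure (Space d))) ξ = g ξ * (besselSymbol d (-s) ξ *
          (𝓕 (hv.toLp v) : Lp ℂ 2 (volume : Measure (Space d))) ξ) := fun ξ => by
      rw [SchwartzMap.smulLeftCLM_apply_apply (besselSymbol_hasTemperateGrowth d (-s)), smul_eq_mul]
      ring
    simp only [e3] at hg
    rw [e2]
    exact hg
  · have hn : ‖(𝓕 (hv.toLp v) : Lp ℂ 2 (volume : Measure (Space d)))‖ₑ = ‖hv.toLp v‖ₑ := by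
      rw [← ofReal_norm, ← ofReal_norm, Lp.norm_fourier_eq]
    rwa [Lp.enorm_def, Lp.enorm_def, eLpNorm_congr_ae hv.coeFn_toLp] at hn

/-- The homogeneous weight scales exactly under dilations of balls; the factor `(2π)² ≥ 1` is
discarded. -/
theorem enorm_besselSymbol_neg_le {d : ℕ} {s : ℝ} (hs : 0 ≤ s) {ξ : Space d} (hξ : ξ ≠ 0) :
    ‖besselSymbol d (-s) ξ‖ₑ ≤ ENNReal.ofReal (‖ξ‖ ^ (-s)) := by
  have h0 : 0 < ‖ξ‖ := norm_pos_iff.2 hξ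
  rw [besselSymbol, ← ofReal_norm, Complex.norm_real, Real.norm_of_nonneg (by positivity)]
  refine ENNReal.ofReal_le_ofReal ?_
  have h1 : ‖ξ‖ ^ (-s) = (‖ξ‖ ^ 2) ^ (-s / 2) := by
    rw [← Real.rpow_natCast, ← Real.rpow_mul h0.le]
    congr 1; push_cast; ring
  rw [h1]
  refine Real.rpow_le_rpow_of_nonpos (by positivity) ?_ (by linarith)
  rw [norm_smul, mul_pow, Real.norm_of_nonneg (by positivity)]
  have : 1 ≤ (2 * Real.pi) ^ 2 := one_le_pow₀ (by linarith [Real.pi_gt_three])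
  nlinarith [sq_nonneg ‖ξ‖]

theorem setLIntegral_ball_norm_rpow {d : ℕ} {a R : ℝ} (hR : 0 < R) :
    ∫⁻ x in Metric.ball (0 : Space d) R, ENNReal.ofReal (‖x‖ ^ (-a)) =
      ENNReal.ofReal (R ^ ((d : ℝ) - a)) *
        ∫⁻ x in Metric.ball (0 : Space d) 1, ENNReal.ofReal (‖x‖ ^ (-a)) := by
  have hmap := Measure.map_addHaar_smul (volume : Measure (Space d)) hR.ne'
  have hm : Measurable fun x : Space d => R • x := measurable_const_smul R
  have hf : Measurable fun x : Space d => ENNReal.ofReal (‖x‖ ^ (-a)) := by fun_prop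
  have h1 := setLIntegral_map (μ := (volume : Measure (Space d))) (s := Metric.ball (0 : Space d) R)
    measurableSet_ball hf hm
  rw [hmap, Measure.restrict_smul, lintegral_smul_measure] at h1
  have hpre : (fun x : Space d => R • x) ⁻¹' Metric.ball 0 R = Metric.ball 0 1 := by
    ext x
    simp [norm_smul, abs_of_pos hR, hR]
  rw [hpre, finrank_euclideanSpace, Fintype.card_fin] at h1
  have hRd : 0 < R ^ d := by positivity
  have h2 : ∀ x : Space d, ENNReal.ofReal (‖R • x‖ ^ (-a)) =
      ENNReal.ofReal (R ^ (-a)) * ENNReal.ofReal (‖x‖ ^ (-a)) := fun x => by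
    rw [norm_smul, Real.norm_of_nonneg hR.le, Real.mul_rpow hR.le (norm_nonneg _),
      ENNReal.ofReal_mul (by positivity)]
  simp_rw [h2] at h1
  rw [lintegral_const_mul _ hf, smul_eq_mul, abs_of_pos (by positivity)] at h1
  calc _ = ENNReal.ofReal (R ^ d) * (ENNReal.ofReal ((R ^ d)⁻¹) *
        ∫⁻ x in Metric.ball (0 : Space d) R, ENNReal.ofReal (‖x‖ ^ (-a))) := by
        rw [← mul_assoc, ← ENNReal.ofReal_mul hRd.le, mul_inv_cancel₀ hRd.ne', ENNReal.ofReal_one,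
          one_mul]
    _ = _ := by
        rw [h1, ← mul_assoc, ← ENNReal.ofReal_mul hRd.le, ← Real.rpow_natCast,
          ← Real.rpow_add hR, ← sub_eq_add_neg]

/-- The low frequencies of `(1 - Δ)^(-s/2) v`, `v ∈ L^2`, are integrable. -/
theorem setLIntegral_ball_besselSymbol_mul_le {d : ℕ} (hd : 0 < d) {s R : ℝ} (hs : 0 ≤ s)
    (hR : 0 < R) {V : Space d → ℂ} (hV : AEStronglyMeasurable V) :
    ∫⁻ ξ in Metric.ball (0 : Space d) R, ‖besselSymbol d (-s) ξ * V ξ‖ₑ ≤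
      (ENNReal.ofReal (R ^ ((d : ℝ) - 2 * s)) * ∫⁻ ξ in Metric.ball (0 : Space d) 1,
        ENNReal.ofReal (‖ξ‖ ^ (-(2 * s)))) ^ (1 / 2 : ℝ) * eLpNorm V 2 volume := by
  have : NeZero d := ⟨hd.ne'⟩
  have hne : ∀ᵐ ξ : Space d, ξ ≠ 0 := Measure.ae_ne volume 0
  have hol := ENNReal.lintegral_mul_le_Lp_mul_Lq
    (volume.restrict (Metric.ball (0 : Space d) R)) Real.HolderConjugate.two_two
    (f := fun ξ => ENNReal.ofReal (‖ξ‖ ^ (-s))) (g := fun ξ => ‖V ξ‖ₑ)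
    (by fun_prop) hV.restrict.enorm
  calc _ ≤ ∫⁻ ξ in Metric.ball (0 : Space d) R, ENNReal.ofReal (‖ξ‖ ^ (-s)) * ‖V ξ‖ₑ := by
        refine lintegral_mono_ae ?_
        filter_upwards [ae_restrict_of_ae hne] with ξ hξ
        rw [enorm_mul]
        gcongr
        exact enorm_besselSymbol_neg_le hs hξ
    _ ≤ _ := hol
    _ ≤ _ := by
        refine mul_le_mul' (le_of_eq ?_) ?_
        · rw [← setLIntegral_ball_norm_rpow hR]
          congr 1
          refine lintegral_congr fun ξ => ?_
          rw [ENNReal.ofReal_rpow_of_nonneg (by positivity) (by norm_num),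
            ← Real.rpow_mul (norm_nonneg _)]
          congr 2; ring
        · rw [eLpNorm_eq_lintegral_rpow_enorm_toReal two_ne_zero ENNReal.ofNat_ne_top]
          simp only [ENNReal.toReal_ofNat]
          exact ENNReal.rpow_le_rpow (setLIntegral_le_lintegral _ _) (by norm_num)

/-- Tonelli on the region `t ≤ ρ ξ`; the inner integral of `t^(r-1)` over `(0, ρ ξ]` is `ρ^r / r`.
The layer-cake argument uses it with `r = p - 2`. -/
theorem lintegral_Ioi_setLIntegral_eq {d : ℕ} {W : Space d → ℂ} (hW : AEStronglyMeasurable W)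
    {ρ : Space d → ℝ} (hρ : Measurable ρ) (hρ0 : ∀ ξ, 0 ≤ ρ ξ) {r : ℝ} (hr : 0 < r) :
    ∫⁻ t in Set.Ioi (0 : ℝ), (∫⁻ ξ in {ξ | ρ ξ < t}ᶜ, ‖W ξ‖ₑ ^ 2) * ENNReal.ofReal (t ^ (r - 1)) =
      ∫⁻ ξ, ‖W ξ‖ₑ ^ 2 * ENNReal.ofReal (ρ ξ ^ r / r) := by
  have hset : ∀ t, MeasurableSet {ξ | ρ ξ < t}ᶜ := fun t =>
    (measurableSet_lt hρ measurable_const).compl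
  have h1 : ∀ t, (∫⁻ ξ in {ξ | ρ ξ < t}ᶜ, ‖W ξ‖ₑ ^ 2) * ENNReal.ofReal (t ^ (r - 1)) =
      ∫⁻ ξ, {z : ℝ × Space d | z.1 ≤ ρ z.2}.indicator
        (fun z => ‖W z.2‖ₑ ^ 2 * ENNReal.ofReal (z.1 ^ (r - 1))) (t, ξ) := by
    intro t
    rw [← lintegral_indicator (hset t), ← lintegral_mul_const' _ _ ENNReal.ofReal_ne_top]
    refine lintegral_congr fun ξ => ?_
    by_cases h : t ≤ ρ ξ
    · rw [Set.indicator_of_mem (by simpa using h), Set.indicator_of_mem (by simpa using h)]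
    · rw [Set.indicator_of_notMem (by simpa using h), Set.indicator_of_notMem (by simpa using h),
        zero_mul]
  simp_rw [h1]
  rw [lintegral_lintegral_swap]
  · refine lintegral_congr fun ξ => ?_
    have h2 : ∀ t, {z : ℝ × Space d | z.1 ≤ ρ z.2}.indicator
        (fun z => ‖W z.2‖ₑ ^ 2 * ENNReal.ofReal (z.1 ^ (r - 1))) (t, ξ) =
        (Set.Iic (ρ ξ)).indicator (fun t => ‖W ξ‖ₑ ^ 2 * ENNReal.ofReal (t ^ (r - 1))) t := by
      intro t
      by_cases h : t ≤ ρ ξ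
      · rw [Set.indicator_of_mem (by simpa using h), Set.indicator_of_mem (by simpa using h)]
      · rw [Set.indicator_of_notMem (by simpa using h), Set.indicator_of_notMem (by simpa using h)]
    simp_rw [h2]
    rw [lintegral_indicator measurableSet_Iic, Measure.restrict_restrict measurableSet_Iic,
      Set.inter_comm, Set.Ioi_inter_Iic, lintegral_const_mul _ (by fun_prop)]
    congr 1
    have hi : IntervalIntegrable (fun t : ℝ => t ^ (r - 1)) volume 0 (ρ ξ) :=
      intervalIntegral.intervalIntegrable_rpow' (by linarith)
    rw [intervalIntegrable_iff_integrableOn_Ioc_of_le (hρ0 ξ)] at hi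
    rw [← ofReal_integral_eq_lintegral_ofReal hi, ← intervalIntegral.integral_of_le (hρ0 ξ),
      integral_rpow (Or.inl (by linarith))]
    · rw [sub_add_cancel, Real.zero_rpow hr.ne', sub_zero]
    · filter_upwards [ae_restrict_mem measurableSet_Ioc] with t ht
      exact Real.rpow_nonneg ht.1.le _
  · refine AEMeasurable.indicator ?_ (measurableSet_le measurable_fst (hρ.comp measurable_snd))
    exact (hW.comp_snd.enorm.pow_const 2).mul (by fun_prop)

/-- The **critical Sobolev embedding** `H^s(ℝ^d) ⊂ L^p(ℝ^d)`, `p = d / (d/2 - s)`. -/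
theorem exists_eLpNorm_le_of_isBesselOf_critical {d : ℕ} {s : ℝ} (hs : 0 < s)
    (hsd : s < (d : ℝ) / 2) :
    ∃ C : ℝ≥0, ∀ u v : Space d → ℂ, IsBesselOf s u v → MemLp v 2 →
      eLpNorm u (ENNReal.ofReal (d / (d / 2 - s))) volume ≤ C * eLpNorm v 2 volume := by
  have hd0 : (0 : ℝ) < d := by linarith
  have hd : 0 < d := by exact_mod_cast hd0
  have : NeZero d := ⟨hd.ne'⟩
  set a : ℝ := (d : ℝ) / 2 - s with ha_def
  have ha : 0 < a := by linarith
  set p : ℝ := (d : ℝ) / a with hp_def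
  have hp0 : 0 < p := by positivity
  have hp2 : p - 2 = 2 * s / a := by
    rw [hp_def, eq_div_iff ha.ne', sub_mul, div_mul_cancel₀ _ ha.ne', ha_def]; ring
  have hp2' : 0 < p - 2 := by rw [hp2]; positivity
  set κ := ∫⁻ ξ in Metric.ball (0 : Space d) 1, ENNReal.ofReal (‖ξ‖ ^ (-(2 * s)))
  have hκ : κ < ∞ := lintegral_ball_norm_rpow_lt_top hd (by linarith)
  -- Adding 1 makes positivity immediate, so that division by `B` below is safe.
  set k : ℝ := κ.toReal + 1 with hk_def
  have hk : 0 < k := by positivity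
  have hκk : κ ≤ ENNReal.ofReal k := by
    rw [← ENNReal.ofReal_toReal hκ.ne]
    exact ENNReal.ofReal_le_ofReal (by rw [hk_def]; linarith)
  -- `p` comes from the layer-cake formula, 4 from Chebyshev at height `t/2`, and the last quotient
  -- from integrating `t^(p-3)` up to `ρ ξ`.
  set c : ℝ := p * (4 * ((2 * √k) ^ (p - 2) / (p - 2))) with hc_def
  have hc : 0 ≤ c := by positivity
  -- the bound with a positive majorant of the norm
  have main : ∀ u v : Space d → ℂ, IsBesselOf s u v → MemLp v 2 → ∀ M : ℝ, 0 < M →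
      eLpNorm v 2 volume ≤ ENNReal.ofReal M →
      eLpNorm u (ENNReal.ofReal p) volume ≤ ENNReal.ofReal (c ^ (1 / p)) * ENNReal.ofReal M := by
    intro u v huv hv M hM hvM
    obtain ⟨T, V, hu, hT, hV, hVv⟩ := exists_fourier_of_isBesselOf huv hv
    have hVM : eLpNorm V 2 volume ≤ ENNReal.ofReal M := hVv.trans_le hvM
    set W : Space d → ℂ := fun ξ => besselSymbol d (-s) ξ * V ξ with hW_def
    have hWV : ∀ᵐ ξ : Space d, ‖W ξ‖ₑ ≤ ENNReal.ofReal (‖ξ‖ ^ (-s)) * ‖V ξ‖ₑ := by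
      filter_upwards [Measure.ae_ne (volume : Measure (Space d)) 0] with ξ hξ
      rw [hW_def, enorm_mul]
      gcongr
      exact enorm_besselSymbol_neg_le hs.le hξ
    have hW : MemLp W 2 := by
      refine hV.of_le hT.aestronglyMeasurable (Filter.Eventually.of_forall fun ξ => ?_)
      rw [hW_def, norm_mul, besselSymbol, Complex.norm_real, Real.norm_of_nonneg (by positivity)]
      refine mul_le_of_le_one_left (norm_nonneg _) ?_
      exact Real.rpow_le_one_of_one_le_of_nonpos (by nlinarith [sq_nonneg ‖(2 * Real.pi) • ξ‖])
        (by linarith)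
    -- Chosen so that on the ball of radius `(t/B)^(1/a)` Cauchy–Schwarz bounds the `L^1` norm of
    -- `W` by `(t/B) √k M = t/2`.
    set B : ℝ := 2 * √k * M with hB_def
    have hB : 0 < B := by positivity
    set ρ : Space d → ℝ := fun ξ => B * ‖ξ‖ ^ a with hρ_def
    have hρm : Measurable ρ := by fun_prop
    have hball : ∀ t : ℝ, 0 < t → {ξ | ρ ξ < t} = Metric.ball 0 ((t / B) ^ a⁻¹) := by
      intro t ht
      ext ξ
      rw [Set.mem_ofPred_eq, mem_ball_zero_iff, Real.lt_rpow_inv_iff_of_pos (norm_nonneg _)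
        (by positivity) ha, lt_div_iff₀ hB, mul_comm]
    have hdist : ∀ t : ℝ, 0 < t → volume {x | t < ‖u x‖} ≤
        ENNReal.ofReal (4 / t ^ 2) * ∫⁻ ξ in {ξ | ρ ξ < t}ᶜ, ‖W ξ‖ₑ ^ 2 := by
      intro t ht
      refine meas_lt_enorm_le hu hT hW (measurableSet_lt hρm measurable_const) ht ?_
      rw [hball t ht]
      refine (setLIntegral_ball_besselSymbol_mul_le hd hs.le (by positivity)
        hV.aestronglyMeasurable).trans ?_
      have e1 : ((t / B) ^ a⁻¹) ^ ((d : ℝ) - 2 * s) = (t / B) ^ 2 := by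
        rw [← Real.rpow_mul (by positivity), ← Real.rpow_natCast]
        congr 1
        rw [show (d : ℝ) - 2 * s = 2 * a by rw [ha_def]; ring]
        field_simp
        norm_num
      rw [e1]
      calc _ ≤ (ENNReal.ofReal ((t / B) ^ 2) * ENNReal.ofReal k) ^ (1 / 2 : ℝ) *
            ENNReal.ofReal M := by gcongr
        _ = _ := by
          rw [← ENNReal.ofReal_mul (by positivity), ENNReal.ofReal_rpow_of_nonneg (by positivity)
            (by norm_num), ← ENNReal.ofReal_mul (by positivity), ← Real.sqrt_eq_rpow,
            Real.sqrt_mul (by positivity), Real.sqrt_sq (by positivity), hB_def]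
          congr 1
          field_simp
    have hcake := lintegral_rpow_eq_lintegral_meas_lt_mul (volume : Measure (Space d))
      (f := fun x => ‖u x‖) (Filter.Eventually.of_forall fun x => norm_nonneg _)
      hu.aestronglyMeasurable.norm.aemeasurable hp0
    have hint : ∫⁻ x, ‖u x‖ₑ ^ p ≤ ENNReal.ofReal (c * M ^ p) := by
      have e0 : ∀ x, ‖u x‖ₑ ^ p = ENNReal.ofReal (‖u x‖ ^ p) := fun x => by
        rw [← ofReal_norm, ENNReal.ofReal_rpow_of_nonneg (norm_nonneg _) hp0.le]
      simp_rw [e0]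
      rw [hcake]
      calc _ ≤ ENNReal.ofReal p * ∫⁻ t in Set.Ioi (0 : ℝ), ENNReal.ofReal 4 *
            ((∫⁻ ξ in {ξ | ρ ξ < t}ᶜ, ‖W ξ‖ₑ ^ 2) * ENNReal.ofReal (t ^ (p - 2 - 1))) := by
            refine mul_le_mul_right (setLIntegral_mono' measurableSet_Ioi fun t ht => ?_) _
            have ht' : (0 : ℝ) < t := ht
            refine (mul_le_mul_left (hdist t ht) _).trans_eq ?_
            have e2 : ENNReal.ofReal (4 / t ^ 2) * ENNReal.ofReal (t ^ (p - 1)) =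
                ENNReal.ofReal 4 * ENNReal.ofReal (t ^ (p - 2 - 1)) := by
              rw [← ENNReal.ofReal_mul (by positivity), ← ENNReal.ofReal_mul (by positivity),
                show p - 1 = (p - 2 - 1) + (2 : ℕ) by push_cast; ring, Real.rpow_add_natCast ht'.ne']
              congr 1
              field_simp
            rw [mul_right_comm, e2]
            ring
        _ = ENNReal.ofReal p * (ENNReal.ofReal 4 *
            ∫⁻ ξ, ‖W ξ‖ₑ ^ 2 * ENNReal.ofReal (ρ ξ ^ (p - 2) / (p - 2))) := by
            rw [lintegral_const_mul' _ _ ENNReal.ofReal_ne_top,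
              lintegral_Ioi_setLIntegral_eq hT.aestronglyMeasurable hρm
                (fun ξ => by positivity) hp2']
        _ ≤ ENNReal.ofReal p * (ENNReal.ofReal 4 *
            ∫⁻ ξ, ENNReal.ofReal (B ^ (p - 2) / (p - 2)) * ‖V ξ‖ₑ ^ 2) := by
            refine mul_le_mul_right (mul_le_mul_right (lintegral_mono_ae ?_) _) _
            filter_upwards [hWV, Measure.ae_ne (volume : Measure (Space d)) 0] with ξ hξ hξ0
            have hn : 0 < ‖ξ‖ := norm_pos_iff.2 hξ0
            calc _ ≤ (ENNReal.ofReal (‖ξ‖ ^ (-s)) * ‖V ξ‖ₑ) ^ 2 *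
                  ENNReal.ofReal (ρ ξ ^ (p - 2) / (p - 2)) := by gcongr
              _ = _ := by
                rw [mul_pow, mul_right_comm, ← ENNReal.ofReal_pow (by positivity),
                  ← ENNReal.ofReal_mul (by positivity)]
                congr 2
                -- Criticality enters here: `a(p - 2) = 2s`, so the power of `|ξ|` from `ρ` cancels
                -- the weight `|ξ|^(-2s)` exactly.
                rw [hρ_def, Real.mul_rpow hB.le (by positivity), ← Real.rpow_mul hn.le,
                  ← Real.rpow_natCast, ← Real.rpow_mul hn.le,
                  show a * (p - 2) = 2 * s by rw [hp2]; field_simp]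
                rw [mul_div_assoc', mul_left_comm, ← Real.rpow_add hn,
                  show -s * ((2 : ℕ) : ℝ) + 2 * s = 0 by push_cast; ring, Real.rpow_zero, mul_one]
        _ ≤ ENNReal.ofReal p * (ENNReal.ofReal 4 *
            (ENNReal.ofReal (B ^ (p - 2) / (p - 2)) * ENNReal.ofReal M ^ 2)) := by
            rw [lintegral_const_mul' _ _ ENNReal.ofReal_ne_top, ← eLpNorm_two_sq]
            gcongr
        _ = _ := by
            rw [← ENNReal.ofReal_pow hM.le, ← ENNReal.ofReal_mul (by positivity),
              ← ENNReal.ofReal_mul (by positivity), ← ENNReal.ofReal_mul (by positivity)]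
            congr 1
            rw [hB_def, Real.mul_rpow (by positivity) hM.le, hc_def,
              show M ^ p = M ^ (p - 2) * M ^ 2 by
                rw [← Real.rpow_add_natCast hM.ne']; congr 1; push_cast; ring]
            ring
    rw [eLpNorm_eq_lintegral_rpow_enorm_toReal (by simpa using hp0) ENNReal.ofReal_ne_top,
      ENNReal.toReal_ofReal hp0.le]
    refine (ENNReal.rpow_le_rpow hint (by positivity)).trans_eq ?_
    rw [ENNReal.ofReal_rpow_of_nonneg (by positivity) (by positivity),
      Real.mul_rpow hc (by positivity), ENNReal.ofReal_mul (by positivity), ← Real.rpow_mul hM.le,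
      mul_one_div_cancel hp0.ne', Real.rpow_one]
  refine ⟨(c ^ (1 / p)).toNNReal, fun u v huv hv => ?_⟩
  have hN := ENNReal.ofReal_toReal hv.eLpNorm_lt_top.ne
  set N : ℝ := (eLpNorm v 2 volume).toReal
  -- The bound needs `M > 0` while the norm of `v` may vanish, so `M` decreases to that norm.
  have hlim : Filter.Tendsto (fun M : ℝ => ENNReal.ofReal (c ^ (1 / p)) * ENNReal.ofReal M)
      (nhdsWithin N (Set.Ioi N))
      (nhds (ENNReal.ofReal (c ^ (1 / p)) * eLpNorm v 2 volume)) := by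
    refine ENNReal.Tendsto.const_mul ?_ (Or.inr ENNReal.ofReal_ne_top)
    have := (ENNReal.continuous_ofReal.tendsto N)
    rw [hN] at this
    exact this.mono_left nhdsWithin_le_nhds
  refine ge_of_tendsto hlim ?_
  filter_upwards [self_mem_nhdsWithin] with M hM
  refine main u v huv hv M (ENNReal.toReal_nonneg.trans_lt hM) ?_
  rw [← hN]
  exact ENNReal.ofReal_le_ofReal (le_of_lt hM)

/-! ### The cubic nonlinearity and the choice of exponents. -/

theorem IsBesselOf.ae_eq {d : ℕ} {s : ℝ} {u v w : Space d → ℂ} (hv : IsBesselOf s u v)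
    (hw : IsBesselOf s u w) : v =ᵐ[volume] w := by
  obtain ⟨S, hS, hSv⟩ := hv
  obtain ⟨T, hT, hTw⟩ := hw
  obtain rfl := hS.unique hT
  exact hSv.ae_eq hTw

theorem normW_eq {d : ℕ} {s : ℝ} {p : ℝ≥0∞} {u v : Space d → ℂ} (hv : MemLp v p)
    (h : IsBesselOf s u v) : normW s p u = eLpNorm v p volume := by
  refine le_antisymm (iInf₂_le v ⟨hv, h⟩) (le_iInf₂ fun w hw => ?_)
  rw [eLpNorm_congr_ae (h.ae_eq hw.2)]

theorem eLpNorm_cubic {d : ℕ} (φ : Space d → ℂ) {q : ℝ} (hq : 0 ≤ q) :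
    eLpNorm (cubic φ) (ENNReal.ofReal q) volume =
      eLpNorm φ (ENNReal.ofReal (3 * q)) volume ^ 3 := by
  have h := eLpNorm_norm_rpow (μ := volume) (p := ENNReal.ofReal q) φ (q := 3) (by norm_num)
  rw [← ENNReal.ofReal_mul hq, mul_comm q] at h
  rw [← ENNReal.rpow_natCast, Nat.cast_ofNat, ← h]
  refine eLpNorm_congr_norm_ae (Filter.Eventually.of_forall fun x => ?_)
  have h3 : ‖φ x‖ ^ (3 : ℝ) = ‖φ x‖ ^ 3 := by exact_mod_cast Real.rpow_natCast ‖φ x‖ 3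
  rw [h3, cubic, norm_mul, Complex.norm_real, norm_pow, norm_norm, norm_pow, norm_norm]
  ring

theorem aestronglyMeasurable_cubic {d : ℕ} {φ : Space d → ℂ} (hφ : AEStronglyMeasurable φ) :
    AEStronglyMeasurable (cubic φ) :=
  (Complex.continuous_ofReal.comp_aestronglyMeasurable (hφ.norm.pow 2)).mul hφ

/-- If `H^s ⊂ L^(3q)` and `(1 - Δ)^(-σ/2) : L^q → L^r` is off the endpoint, then the cubic
nonlinearity maps `H^s` to `W^(-σ,r)`. -/
theorem exists_normW_cubic_le {d : ℕ} (hd : 0 < d) {s σ q r : ℝ} (hσ : 0 < σ) (hq : 1 ≤ q)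
    (hqr : q ≤ r) (hr : 1 < r) (h : 1 / q - 1 / r < σ / d)
    (hsob : ∃ C : ℝ≥0, ∀ u v : Space d → ℂ, IsBesselOf s u v → MemLp v 2 →
      eLpNorm u (ENNReal.ofReal (3 * q)) volume ≤ C * eLpNorm v 2 volume) :
    ∃ C : ℝ≥0, ∀ φ : Space d → ℂ, MemH s φ →
      MemW (-σ) (ENNReal.ofReal r) (cubic φ) ∧
      normW (-σ) (ENNReal.ofReal r) (cubic φ) ≤ C * normH s φ ^ 3 := by
  obtain ⟨C₁, hC₁⟩ := hsob
  obtain ⟨C₂, hC₂⟩ := exists_besselConv_bound hd hσ hq hqr hr h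
  refine ⟨C₂ * C₁ ^ 3, fun φ ⟨v, hv, hφv⟩ => ?_⟩
  have hφ : AEStronglyMeasurable φ := hφv.choose_spec.1.aestronglyMeasurable
  have hle : eLpNorm (cubic φ) (ENNReal.ofReal q) volume ≤ (C₁ * eLpNorm v 2 volume) ^ 3 := by
    rw [eLpNorm_cubic φ (by linarith)]
    exact pow_le_pow_left' (hC₁ φ v hφv hv) 3
  have hcub : MemLp (cubic φ) (ENNReal.ofReal q) :=
    ⟨aestronglyMeasurable_cubic hφ, hle.trans_lt
      (ENNReal.pow_lt_top (ENNReal.mul_lt_top ENNReal.coe_lt_top hv.eLpNorm_lt_top))⟩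
  -- `q ≥ 1` makes the `L^q` function `|φ|²φ` a tempered distribution.
  have : Fact (1 ≤ ENNReal.ofReal q) := ⟨ENNReal.one_le_ofReal.2 hq⟩
  obtain ⟨hmem, hbd, hgiven⟩ := hC₂ (cubic φ) hcub
  have hB : IsBesselOf (-σ) (cubic φ) (besselConv σ (cubic φ)) :=
    ⟨_, isGivenBy_toLp hcub, hgiven _ (isGivenBy_toLp hcub)⟩
  refine ⟨⟨_, hmem, hB⟩, ?_⟩
  rw [normW_eq hmem hB, normH, normW_eq hv hφv]
  refine hbd.trans ((mul_le_mul_right hle _).trans_eq ?_)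
  rw [mul_pow, ENNReal.coe_mul, ENNReal.coe_pow, mul_assoc]

/-- The exponent `q` is chosen so that both Sobolev embeddings are off the endpoint. -/
theorem exists_normW_cubic_le_of_three_le {d : ℕ} (hd : 3 ≤ d) {ε : ℝ} (hε : 0 < ε)
    (hε' : ε < ((d : ℝ) + 2) / 2) :
    ∃ C : ℝ≥0, ∀ φ : Space d → ℂ, MemH (sCrit d + ε) φ →
      MemW (-(sCrit d + ε / 2)) (ENNReal.ofReal (rExp d ε)) (cubic φ) ∧
      normW (-(sCrit d + ε / 2)) (ENNReal.ofReal (rExp d ε)) (cubic φ)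
        ≤ C * normH (sCrit d + ε) φ ^ 3 := by
  have hd3 : (3 : ℝ) ≤ d := by exact_mod_cast hd
  have hd0 : (0 : ℝ) < d := by linarith
  have hden : 0 < (d : ℝ) + 2 * (1 - ε) := by linarith
  have hr0 : 0 < rExp d ε := by unfold rExp; positivity
  have hr : 1 / rExp d ε = 1 / 2 + (1 - ε) / d := by unfold rExp; field_simp
  -- The constraints on `z = 1/q`: `3(1-ε)/d < z` for `H^s ⊂ L^(3q)`, `1/r < z` for `q < r`, and `z
  -- < 1 - ε/(2d) = 1/r + σ/d` for the Bessel potential. The last one also gives `q ≥ 1`; the second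
  -- keeps `z` positive even when `ε > 1`.
  have hlt : max (3 * (1 - ε) / d) (1 / rExp d ε) < 1 - ε / (2 * d) := by
    rw [hr]
    refine max_lt ?_ ?_
    · rw [div_lt_iff₀ hd0, sub_mul, show ε / (2 * d) * d = ε / 2 by field_simp]
      linarith
    · rw [← sub_pos, show 1 - ε / (2 * d) - (1 / 2 + (1 - ε) / d) = (d - 2 + ε) / (2 * d) by
        field_simp; ring]
      have : 0 < (d : ℝ) - 2 + ε := by linarith
      positivity
  obtain ⟨z, hz1, hz2⟩ := exists_between hlt
  have hz3 := (le_max_left _ _).trans_lt hz1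
  have hz4 := (le_max_right _ _).trans_lt hz1
  have hz0 : 0 < z := lt_trans (by positivity) hz4
  have hε2 : 0 < ε / (2 * d) := by positivity
  have hq : 1 ≤ 1 / z := by rw [le_div_iff₀ hz0]; linarith
  have hqr : 1 / z < rExp d ε := by
    rw [div_lt_iff₀ hz0]; rwa [div_lt_iff₀ hr0, mul_comm] at hz4
  refine exists_normW_cubic_le (q := 1 / z) (by omega) (by unfold sCrit; linarith) hq hqr.le
    (by linarith) ?_ ?_
  · rw [one_div_one_div, hr, sCrit]
    have : ((d : ℝ) / 2 - 1 + ε / 2) / d = 1 - ε / (2 * d) - (1 / 2 + (1 - ε) / d) := by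
      field_simp; ring
    linarith
  · obtain ⟨C, hC⟩ := exists_eLpNorm_le_of_isBesselOf (d := d) (s := sCrit d + ε) (q := 2)
      (p := 3 * (1 / z)) (by omega) (by unfold sCrit; linarith) (by norm_num) (by linarith)
      (by linarith) (by
        have e1 : (1 : ℝ) / (3 * (1 / z)) = z / 3 := by field_simp
        have e2 : (sCrit d + ε) / d = 1 / 2 - (3 * (1 - ε) / d) / 3 := by
          unfold sCrit; field_simp; ring
        rw [e1, e2]
        linarith)
    exact ⟨C, by simpa using hC⟩

theorem exists_normW_cubic_le_of_two {ε : ℝ} (hε : 0 < ε) (hε' : ε < 2 / 9) :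
    ∃ C : ℝ≥0, ∀ φ : Space 2 → ℂ, MemH (1 / 3) φ →
      MemW (-(1 / 3 - ε / 2)) (ENNReal.ofReal (rExp 2 ε)) (cubic φ) ∧
      normW (-(1 / 3 - ε / 2)) (ENNReal.ofReal (rExp 2 ε)) (cubic φ)
        ≤ C * normH (1 / 3) φ ^ 3 := by
  have hr : rExp 2 ε = 2 / (2 - ε) := by
    have h1 : 2 - ε ≠ 0 := by linarith
    have h2 : (2 : ℝ) + 2 * (1 - ε) ≠ 0 := by linarith
    unfold rExp
    push_cast
    rw [div_eq_div_iff h2 h1]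
    ring
  have hr1 : 1 < rExp 2 ε := by
    rw [hr, lt_div_iff₀ (by linarith)]; linarith
  -- With `q = 1` the Bessel potential must satisfy `ε/2 < (1/3 - ε/2)/2`, which is exactly `ε <
  -- 2/9`.
  refine exists_normW_cubic_le (q := 1) two_pos (by linarith) le_rfl hr1.le hr1 ?_ ?_
  · rw [hr, one_div_div]; push_cast; linarith
  · obtain ⟨C, hC⟩ := exists_eLpNorm_le_of_isBesselOf_critical (d := 2) (s := 1 / 3)
      (by norm_num) (by norm_num)
    refine ⟨C, ?_⟩
    have : ((2 : ℕ) : ℝ) / (((2 : ℕ) : ℝ) / 2 - 1 / 3) = 3 * 1 := by norm_num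
    rwa [this] at hC

end CubicSobolev

theorem lemma5p5 :
    (∀ d : ℕ, 3 ≤ d → ∀ ε : ℝ, 0 < ε → ε < ((d : ℝ) + 2) / 2 →
      ∃ C : ℝ≥0, ∀ φ : CubicSobolev.Space d → ℂ,
        CubicSobolev.MemH (CubicSobolev.sCrit d + ε) φ →
          CubicSobolev.MemW (-(CubicSobolev.sCrit d + ε / 2))
            (ENNReal.ofReal (CubicSobolev.rExp d ε)) (CubicSobolev.cubic φ) ∧
          CubicSobolev.normW (-(CubicSobolev.sCrit d + ε / 2))
            (ENNReal.ofReal (CubicSobolev.rExp d ε)) (CubicSobolev.cubic φ)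
              ≤ C * CubicSobolev.normH (CubicSobolev.sCrit d + ε) φ ^ 3) ∧
    (∀ ε : ℝ, 0 < ε → ε < 2 / 9 →
      ∃ C : ℝ≥0, ∀ φ : CubicSobolev.Space 2 → ℂ,
        CubicSobolev.MemH (1 / 3) φ →
          CubicSobolev.MemW (-(1 / 3 - ε / 2))
            (ENNReal.ofReal (CubicSobolev.rExp 2 ε)) (CubicSobolev.cubic φ) ∧
          CubicSobolev.normW (-(1 / 3 - ε / 2))
            (ENNReal.ofReal (CubicSobolev.rExp 2 ε)) (CubicSobolev.cubic φ)
              ≤ C * CubicSobolev.normH (1 / 3) φ ^ 3) :=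
  ⟨fun _ hd _ hε hε' => CubicSobolev.exists_normW_cubic_le_of_three_le hd hε hε',
    fun _ hε hε' => CubicSobolev.exists_normW_cubic_le_of_two hε hε'⟩
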